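/- Let $(\Omega,\mathcal F,\mathbb P)$ be a probability space and let $\dot W$ be a Gaussian white noise on $L_2((0,\pi))$, that is, a collection of Gaussian random variables $\dot W(h)$, $h\in L_2((0,\pi))$, with $\mathbb E\,\dot W(g)=0$ and $\mathbb E\big(\dot W(g)\dot W(h)\big)=\int_0^\pi g(x)h(x)\,dx$. Put $\zeta_k=\dot W(\cos(k\,\cdot))$, $k=0,1,2,\dots$ (so $\zeta_0=\dot W(1)$). Consider the random field $$U(t,x)=\frac{t}{\pi}\zeta_0+\frac{2}{\pi}\sum_{k\ge 1}k^{-2}\big(1-e^{-k^2t}\big)\cos(kx)\,\zeta_k,\qquad t\ge 0,\ x\in[0,\pi].$$ For every $t>0$ and $x\in[0,\pi]$ this series converges absolutely with probability one. The field $U$ is a solution of the additive-noise equation $$U_t=U_{xx}+\dot W(x),\ t>0,\ 0<x<\pi,\qquad U(0,x)=0,\quad U_x(t,0)=U_x(t,\pi)=0,$$ in the following sense: with probability one $U$ is continuous on $[0,\infty)\times[0,\pi]$ and $U(0,\cdot)=0$, and for every twice continuously differentiable $\varphi$ with $\varphi'(0)=\varphi'(\pi)=0$, with probability one, for all $t\ge0$,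 $$\int_0^\pi U(t,x)\varphi(x)\,dx=\int_0^t\!\int_0^\pi U(s,x)\varphi''(x)\,dx\,ds+t\,\dot W(\varphi).$$ Let $U_x$ be the derivative of $U$ in $x$ on $[0,\pi]$ (one-sided at the end points). For every $t>0$ and $x\in[0,\pi]$, with probability one, $$U_x(t,x)=-\frac{2}{\pi}\sum_{k\ge1}k^{-1}\big(1-e^{-k^2t}\big)\sin(kx)\,\zeta_k ,$$ the series being the limit of its partial sums. For $0<\gamma\le1$ write $f\in\mathcal C^{\gamma}((a,b))$ if $\sup_{x\ne y\in(a,b)}|f(x)-f(y)|/|x-y|^{\gamma}<\infty$; for $0<\alpha\le1$ write $f\in\mathcal C^{1+\alpha}((a,b))$ if $f$ is continuously differentiable on $[a,b]$ and $f'\in\mathcal C^{\alpha}((a,b))$; and write $f\in\mathcal C^{\beta-}((a,b))$ if $f\in\mathcal C^{\beta-\varepsilon}((a,b))$ for every $\varepsilon\in(0,\beta)$. Then: - for every $x\in[0,\pi]$ and $T>0$, with probability one, $U(\cdot,x)\in\mathcal C^{3/4-}((0,T))$; - for every $x\in[0,\pi]$ and $T>0$, with probability one, $U_x(t,x)$ exists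 for all $t\in(0,T)$ and $U_x(\cdot,x)\in\mathcal C^{1/4-}((0,T))$; - for every $t>0$, with probability one, $U(t,\cdot)\in\mathcal C^{3/2-}((0,\pi))$. -/

import Mathlib

open MeasureTheory ProbabilityTheory Set Filter Topology
open scoped NNReal

namespace AdditiveNoise

noncomputable section

/-- Lebesgue measure on the interval `(0, π)`. -/
abbrev lebesgue : Measure ℝ := volume.restrict (Ioo 0 Real.pi)

/-- The Hilbert space `L₂((0, π))`. -/
abbrev L2 : Type := Lp ℝ 2 lebesgue

theorem memLp_of_continuous {g : ℝ → ℝ} (hg : Continuous g) : MemLp g 2 lebesgue := by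
  obtain ⟨C, hC⟩ := isCompact_Icc.exists_bound_of_continuousOn
    (s := Icc (0 : ℝ) Real.pi) hg.continuousOn
  refine MemLp.of_bound hg.aestronglyMeasurable C ?_
  filter_upwards [ae_restrict_mem measurableSet_Ioo] with x hx
  exact hC x (Ioo_subset_Icc_self hx)

/-- The class in `L₂((0, π))` of (the restriction of) a continuous function. -/
def toL2 (g : ℝ → ℝ) (hg : Continuous g) : L2 := (memLp_of_continuous hg).toLp g

variable {Ω : Type*} [MeasurableSpace Ω]

/-- A Gaussian white noise on `L₂((0, π))`: a collection of Gaussian random variables `W h`,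
`h ∈ L₂((0, π))`, with mean zero and `E (W g * W h) = (g, h)₀`. -/
structure IsWhiteNoise (P : Measure Ω) (W : L2 → Ω → ℝ) : Prop where
  gaussian : ∀ h, HasGaussianLaw (W h) P
  mean : ∀ h, ∫ ω, W h ω ∂P = 0
  covariance : ∀ g h, ∫ ω, W g ω * W h ω ∂P = inner ℝ g h

/-- `ζ_k = ∫_0^π cos (k x) dW(x)`; in particular `ζ_0 = W(π)`, the noise of the constant `1`. -/
def zeta (W : L2 → Ω → ℝ) (k : ℕ) : Ω → ℝ :=
  W (toL2 (fun x => Real.cos (k * x)) (by fun_prop))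

/-- The term of index `k ≥ 1` in the series for `U`. -/
def uTerm (W : L2 → Ω → ℝ) (t x : ℝ) (ω : Ω) (k : ℕ) : ℝ :=
  ((k : ℝ) ^ 2)⁻¹ * (1 - Real.exp (-(k : ℝ) ^ 2 * t)) * Real.cos (k * x) * zeta W k ω

/-- The random field
`U(t,x) = (t/π) ζ_0 + (2/π) ∑_{k ≥ 1} k⁻² (1 - exp (-k² t)) cos (k x) ζ_k`. -/
def U (W : L2 → Ω → ℝ) (t x : ℝ) (ω : Ω) : ℝ :=
  t / Real.pi * zeta W 0 ω + 2 / Real.pi * ∑' k : ℕ, uTerm W t x ω (k + 1)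

/-- The partial derivative `u_x(t, x)` of a random field `u` on `[0, π]`
(one-sided at the two end points). -/
def spaceDeriv (u : ℝ → ℝ → Ω → ℝ) (t x : ℝ) (ω : Ω) : ℝ :=
  derivWithin (fun y => u t y ω) (Icc 0 Real.pi) x

/-- The term of index `k ≥ 1` in the series for `U_x`, without the factor `-2/π`. -/
def uxTerm (W : L2 → Ω → ℝ) (t x : ℝ) (ω : Ω) (k : ℕ) : ℝ :=
  (k : ℝ)⁻¹ * (1 - Real.exp (-(k : ℝ) ^ 2 * t)) * Real.sin (k * x) * zeta W k ω

/-- `u` is a (continuous, weak) solution of `u_t = u_xx + Ẇ(x)` for `t > 0`, `0 < x < π`, with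
`u(0, ·) = 0` and zero Neumann boundary conditions: test functions are the `C²` functions `φ`
with `φ'(0) = φ'(π) = 0`. -/
structure IsNeumannSolution (P : Measure Ω) (W : L2 → Ω → ℝ) (u : ℝ → ℝ → Ω → ℝ) : Prop where
  continuous : ∀ᵐ ω ∂P,
    ContinuousOn (fun z : ℝ × ℝ => u z.1 z.2 ω) (Ici 0 ×ˢ Icc 0 Real.pi)
  initial : ∀ᵐ ω ∂P, ∀ x ∈ Icc 0 Real.pi, u 0 x ω = 0
  equation : ∀ (φ : ℝ → ℝ) (hφ : ContDiff ℝ 2 φ), deriv φ 0 = 0 → deriv φ Real.pi = 0 →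
    ∀ᵐ ω ∂P, ∀ t : ℝ, 0 ≤ t →
      ∫ x in 0..Real.pi, u t x ω * φ x =
        (∫ s in 0..t, ∫ x in 0..Real.pi, u s x ω * iteratedDeriv 2 φ x)
          + t * W (toL2 φ hφ.continuous) ω

/-- `f ∈ C^γ((a, b))` for `0 < γ ≤ 2`: Hölder of order `γ` if `γ ≤ 1`; if `γ = 1 + α > 1`,
continuously differentiable on `[a, b]` with `f'` Hölder of order `α` on `(a, b)`. -/
def HolderClass (γ : ℝ) (f : ℝ → ℝ) (a b : ℝ) : Prop :=
  (γ ≤ 1 → ∃ C : ℝ≥0, HolderOnWith C γ.toNNReal f (Ioo a b)) ∧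
  (1 < γ → ContDiffOn ℝ 1 f (Icc a b) ∧
    ∃ C : ℝ≥0, HolderOnWith C (γ - 1).toNNReal (derivWithin f (Icc a b)) (Ioo a b))

/-- `f ∈ C^{β-}((a, b))`, that is, `f` is almost Hölder(`β`), for `0 < β ≤ 2`. -/
def AlmostHolder (β : ℝ) (f : ℝ → ℝ) (a b : ℝ) : Prop :=
  ∀ ε : ℝ, 0 < ε → ε < β → HolderClass (β - ε) f a b

end

end AdditiveNoise

namespace AdditiveNoise

section

variable {Ω : Type*} [MeasurableSpace Ω] {P : Measure Ω} {W : L2 → Ω → ℝ}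

/-! ### Almost sure linearity, Gaussian tails and Borel–Cantelli -/

namespace IsWhiteNoise

/-! The probability enters through one estimate, `ae_exists_forall_abs_le`. The covariance makes `W`
almost surely linear, so a finite sum `∑ c_k ζ_k` is again a value of `W`, hence a centred Gaussian
whose variance is at most `π ∑ c_k²` by orthogonality of the cosines. Thus neither independence nor
joint Gaussianity is invoked. A union bound and Borel–Cantelli then control exponentially many such
variables at level `j` by `C (j + 1)` standard deviations.

For a series `∑ c_k(x) ζ_k` with `|c_k| ≤ k⁻ᵃ`, this is applied to the dyadic blocks `2^j ≤ k <
2^(j+1)` at the points of a fine grid and extended to all `x` by a Lipschitz bound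
(`ae_exists_block_abs_le`). A block has size about `(j + 1) 2^(j/2) 2^(-aj)`: the square root of the
number of terms replaces that number. If each derivative costs a factor `k^m`, interpolating between
a block and its derivative bounds its `γ`-Hölder increments by a constant times `(j + 1) 2^(j (1/2 -
a + mγ))`. This is summable in `j` exactly when `γ m + 1/2 < a` (`ae_exists_holder_partial_sums`).

The exponents follow: `U` in time has `a = 2`, `m = 2`, so `γ < 3/4`; `U_x` in time has `a = 1`, `m
= 2`, so `γ < 1/4`; `U_x` in space has `a = 1`, `m = 1`, so `γ < 1/2`, which is `3/2` for `U`. The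
block bounds also give uniform convergence of the series for `U_x`, although that series is not
treated as absolutely convergent.

The weak equation is checked mode by mode. The cosine coefficients of `φ''` are `-k²` times those of
`φ` because of the Neumann conditions, `W(φ)` equals its cosine series almost surely
(`ae_toL2_eq_tsum`), and each mode solves a linear ODE in `t`. -/

theorem memLp (hW : IsWhiteNoise P W) (h : L2) : MemLp (W h) 2 P :=
  (hW.gaussian h).memLp_two

theorem integrable_mul (hW : IsWhiteNoise P W) (g h : L2) :
    Integrable (fun ω => W g ω * W h ω) P :=
  (hW.memLp g).integrable_mul (hW.memLp h)

theorem integral_sq_combination (hW : IsWhiteNoise P W) (a b c : ℝ) (f g h : L2) :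
    ∫ ω, (a * W f ω + b * W g ω + c * W h ω) ^ 2 ∂P = ‖a • f + b • g + c • h‖ ^ 2 := by
  have e : ∀ ω, (a * W f ω + b * W g ω + c * W h ω) ^ 2 =
      (a ^ 2 * (W f ω * W f ω) + b ^ 2 * (W g ω * W g ω) + c ^ 2 * (W h ω * W h ω)) +
      (2 * a * b * (W f ω * W g ω) + 2 * a * c * (W f ω * W h ω) +
        2 * b * c * (W g ω * W h ω)) := fun ω => by ring
  have i := fun (r : ℝ) (g h : L2) => (hW.integrable_mul g h).const_mul r
  simp_rw [e]
  rw [integral_add, integral_add, integral_add, integral_add, integral_add]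
  rotate_left
  iterate 10 first
    | exact i _ _ _
    | exact (i _ _ _).add (i _ _ _)
    | exact ((i _ _ _).add (i _ _ _)).add (i _ _ _)
  simp_rw [integral_const_mul, hW.covariance]
  rw [← real_inner_self_eq_norm_sq]
  simp only [inner_add_left, inner_add_right, real_inner_smul_left, real_inner_smul_right]
  rw [real_inner_comm f g, real_inner_comm f h, real_inner_comm g h]
  ring

theorem memLp_combination (hW : IsWhiteNoise P W) (a b c : ℝ) (f g h : L2) :
    MemLp (fun ω => a * W f ω + b * W g ω + c * W h ω) 2 P :=
  (((hW.memLp f).const_mul a).add ((hW.memLp g).const_mul b)).add ((hW.memLp h).const_mul c)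

/-- Linearity of `W` is not part of `IsWhiteNoise`; it is recovered here because the second moment
of the combination is the squared norm of the zero vector. Three terms suffice for both additivity
and homogeneity. -/
theorem ae_combination_eq_zero (hW : IsWhiteNoise P W) {a b c : ℝ} {f g h : L2}
    (h0 : a • f + b • g + c • h = 0) :
    ∀ᵐ ω ∂P, a * W f ω + b * W g ω + c * W h ω = 0 := by
  have := hW.integral_sq_combination a b c f g h
  rw [h0, norm_zero, zero_pow two_ne_zero,
    integral_eq_zero_iff_of_nonneg (fun ω => sq_nonneg _)
      (hW.memLp_combination a b c f g h).integrable_sq] at this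
  filter_upwards [this] with ω hω
  simpa using hω

theorem ae_add (hW : IsWhiteNoise P W) (g h : L2) :
    ∀ᵐ ω ∂P, W (g + h) ω = W g ω + W h ω := by
  filter_upwards [hW.ae_combination_eq_zero (a := 1) (b := -1) (c := -1) (f := g + h) (g := g)
    (h := h) (by module)] with ω hω
  linarith

theorem ae_smul (hW : IsWhiteNoise P W) (r : ℝ) (h : L2) :
    ∀ᵐ ω ∂P, W (r • h) ω = r * W h ω := by
  filter_upwards [hW.ae_combination_eq_zero (a := 1) (b := -r) (c := 0) (f := r • h) (g := h)
    (h := h) (by module)] with ω hω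
  linarith

theorem ae_sum (hW : IsWhiteNoise P W) {ι : Type*} (s : Finset ι) (c : ι → ℝ) (h : ι → L2) :
    ∀ᵐ ω ∂P, W (∑ i ∈ s, c i • h i) ω = ∑ i ∈ s, c i * W (h i) ω := by
  classical
  induction s using Finset.induction_on with
  | empty =>
    filter_upwards [hW.ae_smul 0 0] with ω hω
    simpa using hω
  | insert i s hi ih =>
    filter_upwards [ih, hW.ae_smul (c i) (h i), hW.ae_add (c i • h i) (∑ i ∈ s, c i • h i)]
      with ω h1 h2 h3
    rw [Finset.sum_insert hi, Finset.sum_insert hi, h3, h2, h1]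

theorem map_eq_gaussianReal (hW : IsWhiteNoise P W) (h : L2) :
    P.map (W h) = gaussianReal 0 (‖h‖ ^ 2).toNNReal := by
  have := hW.gaussian h
  have hP := this.isProbabilityMeasure
  rw [this.map_eq_gaussianReal, hW.mean h, variance_of_integral_eq_zero this.aemeasurable
    (hW.mean h), ← real_inner_self_eq_norm_sq, ← hW.covariance]
  simp [sq]

/-- Chernoff's bound with parameter `l / σ`, applied to `W h` and to `-W h`. Taking an upper bound
`σ` in place of the norm itself admits degenerate `h`. -/
theorem measureReal_abs_ge_le (hW : IsWhiteNoise P W) {h : L2} {σ : ℝ} (hσ : 0 < σ)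
    (hh : ‖h‖ ≤ σ) {l : ℝ} (hl : 0 ≤ l) :
    P.real {ω | l * σ ≤ |W h ω|} ≤ 2 * Real.exp (-l ^ 2 / 2) := by
  have hP := (hW.gaussian h).isProbabilityMeasure
  have key : ∀ X : Ω → ℝ, P.map X = gaussianReal 0 (‖h‖ ^ 2).toNNReal →
      P.real {ω | l * σ ≤ X ω} ≤ Real.exp (-l ^ 2 / 2) := by
    intro X hX
    have hm : AEMeasurable X P := by
      by_contra hcon
      -- Without measurability the push-forward would be the zero measure, not a probability
      -- measure.
      rw [Measure.map_of_not_aemeasurable hcon] at hX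
      exact (IsProbabilityMeasure.ne_zero (gaussianReal 0 (‖h‖ ^ 2).toNNReal)) hX.symm
    have hint : Integrable (fun ω => Real.exp (l / σ * X ω)) P := by
      have := integrable_exp_mul_gaussianReal (μ := 0) (v := (‖h‖ ^ 2).toNNReal) (l / σ)
      rw [← hX] at this
      exact this.comp_aemeasurable hm
    refine (measure_ge_le_exp_mul_mgf (l * σ) (t := l / σ) (by positivity) hint).trans ?_
    rw [mgf_gaussianReal hX, ← Real.exp_add, Real.exp_le_exp, Real.coe_toNNReal _ (sq_nonneg _)]
    have h1 : ‖h‖ ^ 2 * (l / σ) ^ 2 ≤ σ ^ 2 * (l / σ) ^ 2 := by gcongr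
    have h2 : σ ^ 2 * (l / σ) ^ 2 = l ^ 2 := by field_simp
    have h3 : l / σ * (l * σ) = l ^ 2 := by field_simp
    nlinarith
  have h1 := key (W h) (hW.map_eq_gaussianReal h)
  have h2 := key (fun ω => -W h ω) (by
    have : (fun ω => -W h ω) = (fun x => -x) ∘ W h := rfl
    rw [this, ← AEMeasurable.map_map_of_aemeasurable (by fun_prop) (hW.gaussian h).aemeasurable,
      hW.map_eq_gaussianReal, gaussianReal_map_neg, neg_zero])
  calc P.real {ω | l * σ ≤ |W h ω|}
      ≤ P.real ({ω | l * σ ≤ W h ω} ∪ {ω | l * σ ≤ -W h ω}) := by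
        refine measureReal_mono fun ω hω => ?_
        simpa [le_abs] using hω
    _ ≤ _ := measureReal_union_le _ _
    _ ≤ _ := by linarith

/-- Maxima over finite families of exponentially growing cardinality. -/
theorem ae_exists_forall_abs_le (hW : IsWhiteNoise P W) {ι : Type*} (I : ℕ → Finset ι)
    (h : ℕ → ι → L2) {σ : ℕ → ℝ} (hσ : ∀ j, 0 < σ j) (hh : ∀ j, ∀ i ∈ I j, ‖h j i‖ ≤ σ j)
    {K A : ℝ} (hA : 0 < A) (hI : ∀ j, ((I j).card : ℝ) ≤ K * A ^ j) :
    ∀ᵐ ω ∂P, ∃ C : ℝ, 0 ≤ C ∧ ∀ j, ∀ i ∈ I j, |W (h j i) ω| ≤ C * ((j + 1) * σ j) := by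
  have hP := (hW.gaussian 0).isProbabilityMeasure
  have hK : 0 ≤ K := by simpa using (Nat.cast_nonneg _).trans (hI 0)
  -- At `j + 1` standard deviations the tail `exp (-(j + 1)² / 2)` beats the cardinality `K A ^ j`
  -- for every `A`.
  let s : ℕ → Set Ω := fun j => ⋃ i ∈ I j, {ω | ((j : ℝ) + 1) * σ j ≤ |W (h j i) ω|}
  have hs : ∀ j, P.real (s j) ≤ K * A ^ j * (2 * Real.exp (-((j : ℝ) + 1) ^ 2 / 2)) := by
    intro j
    calc P.real (s j) ≤ ∑ i ∈ I j, P.real {ω | ((j : ℝ) + 1) * σ j ≤ |W (h j i) ω|} :=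
          measureReal_biUnion_finset_le _ _
      _ ≤ ∑ i ∈ I j, 2 * Real.exp (-((j : ℝ) + 1) ^ 2 / 2) :=
          Finset.sum_le_sum fun i hi =>
            hW.measureReal_abs_ge_le (hσ j) (hh j i hi) (by positivity)
      _ ≤ _ := by
          rw [Finset.sum_const, nsmul_eq_mul]
          gcongr
          exact hI j
  have hsum : Summable fun j : ℕ => K * A ^ j * (2 * Real.exp (-((j : ℝ) + 1) ^ 2 / 2)) := by
    -- This `m` gives `j log A - (j + 1)² / 2 ≤ m² - j`, so the series is dominated by a geometric
    -- one.
    obtain ⟨m, hm⟩ := exists_nat_gt (Real.log A + 1)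
    have hb : Summable fun j : ℕ => 2 * K * Real.exp (m ^ 2) * Real.exp (-j) :=
      (Real.summable_exp_neg_nat).mul_left _
    refine Summable.of_nonneg_of_le (fun j => by positivity) (fun j => ?_) hb
    have : A ^ j = Real.exp (j * Real.log A) := by
      rw [mul_comm, Real.exp_mul, Real.exp_log hA, Real.rpow_natCast]
    rw [this]
    have e : K * Real.exp (j * Real.log A) * (2 * Real.exp (-((j : ℝ) + 1) ^ 2 / 2)) =
        2 * K * Real.exp (j * Real.log A + (-((j : ℝ) + 1) ^ 2 / 2)) := by
      rw [Real.exp_add]; ring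
    rw [e, mul_assoc (2 * K), ← Real.exp_add]
    refine mul_le_mul_of_nonneg_left (Real.exp_le_exp.2 ?_) (by positivity)
    have hj : (0 : ℝ) ≤ j := by positivity
    nlinarith [mul_le_mul_of_nonneg_left hm.le hj, sq_nonneg ((j : ℝ) - m), sq_nonneg (m : ℝ)]
  have hfin : ∑' j, P (s j) ≠ ⊤ := by
    have : ∀ j, P (s j) ≤
        ENNReal.ofReal (K * A ^ j * (2 * Real.exp (-((j : ℝ) + 1) ^ 2 / 2))) := fun j => by
      rw [← ofReal_measureReal (measure_ne_top _ _)]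
      exact ENNReal.ofReal_le_ofReal (hs j)
    refine ne_top_of_le_ne_top ?_ (ENNReal.tsum_le_tsum this)
    rw [← ENNReal.ofReal_tsum_of_nonneg (fun j => by positivity) hsum]
    exact ENNReal.ofReal_ne_top
  filter_upwards [ae_eventually_notMem hfin] with ω hω
  obtain ⟨n, hn⟩ := eventually_atTop.1 hω
  -- The finitely many levels before Borel–Cantelli takes effect are absorbed into the constant.
  let D : ℕ → ℝ := fun j => ∑ i ∈ I j, |W (h j i) ω| / σ j
  have hD : ∀ j, 0 ≤ D j := fun j =>
    Finset.sum_nonneg fun i _ => div_nonneg (abs_nonneg _) (hσ j).le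
  refine ⟨1 + ∑ j ∈ Finset.range n, D j,
    add_nonneg zero_le_one (Finset.sum_nonneg fun j _ => hD j), fun j i hi => ?_⟩
  have hj : (0 : ℝ) < ((j : ℝ) + 1) * σ j := mul_pos (by positivity) (hσ j)
  have hS : 0 ≤ ∑ j ∈ Finset.range n, D j := Finset.sum_nonneg fun j _ => hD j
  by_cases hjn : n ≤ j
  · have := hn j hjn
    simp only [s, mem_iUnion, mem_ofPred_eq, not_exists, not_le] at this
    nlinarith [this i hi]
  · have h1 : |W (h j i) ω| / σ j ≤ D j :=
      Finset.single_le_sum (f := fun i => |W (h j i) ω| / σ j)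
        (fun i _ => div_nonneg (abs_nonneg _) (hσ j).le) hi
    have h2 : D j ≤ ∑ j ∈ Finset.range n, D j :=
      Finset.single_le_sum (f := D) (fun i _ => hD i) (Finset.mem_range.2 (not_le.1 hjn))
    rw [div_le_iff₀ (hσ j)] at h1
    have hσj := hσ j
    have hj' : (0 : ℝ) ≤ j := by positivity
    calc |W (h j i) ω| ≤ D j * σ j := h1
      _ ≤ (1 + ∑ j ∈ Finset.range n, D j) * (1 * σ j) := by
        rw [one_mul]; gcongr; linarith
      _ ≤ _ := by gcongr; linarith

end IsWhiteNoise

/-! ### Orthogonality of the cosines -/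

/-- The class of `cos (k ·)` in `L₂((0, π))`. -/
noncomputable def cosL2 (k : ℕ) : L2 := toL2 (fun x => Real.cos (k * x)) (by fun_prop)

theorem inner_toL2 {f g : ℝ → ℝ} (hf : Continuous f) (hg : Continuous g) :
    inner ℝ (toL2 f hf) (toL2 g hg) = ∫ x in 0..Real.pi, f x * g x := by
  rw [L2.inner_def, intervalIntegral.integral_of_le Real.pi_pos.le,
    integral_Ioc_eq_integral_Ioo]
  refine integral_congr_ae ?_
  filter_upwards [(memLp_of_continuous hf).coeFn_toLp, (memLp_of_continuous hg).coeFn_toLp]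
    with x h1 h2
  simp [toL2, h1, h2, mul_comm]

theorem integral_cos_natCast_mul {k : ℕ} (hk : k ≠ 0) :
    ∫ x in 0..Real.pi, Real.cos (k * x) = 0 := by
  have hk' : (k : ℝ) ≠ 0 := by exact_mod_cast hk
  rw [intervalIntegral.integral_comp_mul_left (f := Real.cos) hk']
  simp [integral_cos, Real.sin_nat_mul_pi]

theorem integral_cos_mul_cos {j k : ℕ} (h : j ≠ k) :
    ∫ x in 0..Real.pi, Real.cos (j * x) * Real.cos (k * x) = 0 := by
  wlog hjk : k < j generalizing j k
  · simpa [mul_comm] using this h.symm (lt_of_le_of_ne (not_lt.1 hjk) h)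
  have e : ∀ x : ℝ, Real.cos (j * x) * Real.cos (k * x) =
      (Real.cos ((j + k : ℕ) * x) + Real.cos ((j - k : ℕ) * x)) / 2 := by
    intro x
    rw [Nat.cast_add, Nat.cast_sub hjk.le, add_mul, sub_mul, Real.cos_add, Real.cos_sub]
    ring
  simp_rw [e]
  rw [intervalIntegral.integral_div, intervalIntegral.integral_add
    (Continuous.intervalIntegrable (by fun_prop) _ _)
    (Continuous.intervalIntegrable (by fun_prop) _ _),
    integral_cos_natCast_mul (by omega), integral_cos_natCast_mul (by omega)]
  simp

theorem norm_sq_toL2_le {f : ℝ → ℝ} (hf : Continuous f) {C : ℝ}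
    (hC : ∀ x ∈ Icc 0 Real.pi, |f x| ≤ C) : ‖toL2 f hf‖ ^ 2 ≤ Real.pi * C ^ 2 := by
  rw [← real_inner_self_eq_norm_sq, inner_toL2]
  calc ∫ x in 0..Real.pi, f x * f x ≤ ∫ x in 0..Real.pi, C ^ 2 := by
        refine intervalIntegral.integral_mono_on Real.pi_pos.le
          (Continuous.intervalIntegrable (by fun_prop) _ _)
          (Continuous.intervalIntegrable (by fun_prop) _ _) fun x hx => ?_
        nlinarith [abs_le.1 (hC x hx)]
    _ = _ := by simp

theorem norm_sq_sum_smul_cosL2_le (s : Finset ℕ) (c : ℕ → ℝ) :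
    ‖∑ k ∈ s, c k • cosL2 k‖ ^ 2 ≤ Real.pi * ∑ k ∈ s, c k ^ 2 := by
  rw [← real_inner_self_eq_norm_sq, sum_inner, Finset.mul_sum]
  refine Finset.sum_le_sum fun k hk => ?_
  rw [inner_sum, Finset.sum_eq_single k]
  · rw [real_inner_smul_left, real_inner_smul_right, real_inner_self_eq_norm_sq]
    have : ‖cosL2 k‖ ^ 2 ≤ Real.pi * 1 ^ 2 :=
      norm_sq_toL2_le _ fun x _ => Real.abs_cos_le_one _
    nlinarith [mul_le_mul_of_nonneg_left this (sq_nonneg (c k))]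
  · intro j _ hjk
    rw [real_inner_smul_left, real_inner_smul_right]
    have : inner ℝ (cosL2 k) (cosL2 j) = 0 := by
      rw [cosL2, cosL2, inner_toL2, integral_cos_mul_cos hjk.symm]
    rw [this]; simp
  · exact fun h => absurd hk h

end

/-! ### Uniform bounds for dyadic blocks -/

section

variable {Ω : Type*} [MeasurableSpace Ω] {P : Measure Ω} {W : L2 → Ω → ℝ}

theorem exists_grid_point {p q x : ℝ} (hpq : p < q) (hx : x ∈ Icc p q) {N : ℕ} (hN : 0 < N) :
    ∃ i ≤ N, p + (q - p) * i / N ∈ Icc p q ∧ |x - (p + (q - p) * i / N)| ≤ (q - p) / N := by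
  have hd : 0 < q - p := sub_pos.2 hpq
  have hN' : (0 : ℝ) < N := by exact_mod_cast hN
  have hy0 : 0 ≤ (x - p) / (q - p) * N :=
    mul_nonneg (div_nonneg (sub_nonneg.2 hx.1) hd.le) hN'.le
  have h1 := Nat.floor_le hy0
  have h2 := Nat.lt_floor_add_one ((x - p) / (q - p) * N)
  have hxN : (x - p) / (q - p) * N ≤ N := by
    have : (x - p) / (q - p) ≤ 1 := (div_le_one hd).2 (by linarith [hx.2])
    nlinarith
  set i := ⌊(x - p) / (q - p) * N⌋₊
  have e : (x - p) / (q - p) * N * ((q - p) / N) = x - p := by field_simp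
  have e' : (q - p) * i / N = i * ((q - p) / N) := by ring
  have hdN : 0 < (q - p) / N := by positivity
  have h3 : (i : ℝ) * ((q - p) / N) ≤ x - p := by
    rw [← e]; gcongr
  have h4 : x - p ≤ (i + 1) * ((q - p) / N) := by
    rw [← e]; gcongr
  refine ⟨i, by exact_mod_cast h1.trans hxN, ?_, ?_⟩
  · rw [e']
    exact ⟨le_add_of_nonneg_right (by positivity), by linarith [hx.2]⟩
  · rw [e', abs_le]
    constructor <;> linarith

theorem natCast_add_one_le_sqrt (j : ℕ) : (j : ℝ) + 1 ≤ 2 * √(2 ^ j) := by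
  have h : ∀ j : ℕ, (j + 1) ^ 2 ≤ 4 * 2 ^ j := by
    intro j
    rcases le_or_gt j 1 with h | h
    · interval_cases j <;> norm_num
    · induction j, h using Nat.le_induction with
      | base => norm_num
      | succ n hn ih => rw [pow_succ 2 n]; nlinarith
  have h' : ((j : ℝ) + 1) ^ 2 ≤ 4 * 2 ^ j := by exact_mod_cast h j
  refine abs_le_of_sq_le_sq' ?_ (by positivity) |>.2
  rw [mul_pow, Real.sq_sqrt (by positivity)]
  linarith

namespace IsWhiteNoise

/-- Borel–Cantelli on dyadic blocks of indices gives logarithmic growth; the weaker `√k` is enough,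
both against `k⁻²` in the series for `U` and in the discretization error below. -/
theorem ae_exists_abs_zeta_le (hW : IsWhiteNoise P W) :
    ∀ᵐ ω ∂P, ∃ C : ℝ, 0 ≤ C ∧ ∀ k : ℕ, k ≠ 0 → |zeta W k ω| ≤ C * √k := by
  have hσ : ∀ k, ‖cosL2 k‖ ≤ √Real.pi := fun k => by
    refine Real.le_sqrt_of_sq_le ?_
    have := norm_sq_toL2_le (f := fun x => Real.cos (k * x)) (by fun_prop)
      fun x _ => Real.abs_cos_le_one (k * x)
    rw [one_pow, mul_one] at this
    exact this
  filter_upwards [hW.ae_exists_forall_abs_le (fun j => Finset.Ico (2 ^ j) (2 ^ (j + 1)))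
    (fun _ k => cosL2 k) (σ := fun _ => √Real.pi) (fun _ => by positivity)
    (fun _ k _ => hσ k) (K := 1) (A := 2) two_pos
    (fun j => by rw [Nat.card_Ico, pow_succ]; rw [Nat.cast_sub (by omega)]; push_cast; linarith)]
    with ω ⟨C, hC, h⟩
  refine ⟨2 * C * √Real.pi, by positivity, fun k hk => ?_⟩
  have h1 : 2 ^ Nat.log 2 k ≤ k := Nat.pow_log_le_self 2 hk
  refine (h (Nat.log 2 k) k (Finset.mem_Ico.2
    ⟨h1, Nat.lt_pow_succ_log_self (by norm_num) k⟩)).trans ?_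
  have h2 : √(2 ^ Nat.log 2 k) ≤ √k := Real.sqrt_le_sqrt (by exact_mod_cast h1)
  calc C * ((Nat.log 2 k + 1) * √Real.pi) ≤ C * ((2 * √k) * √Real.pi) := by
        gcongr
        exact (natCast_add_one_le_sqrt _).trans (by gcongr)
    _ = _ := by ring

theorem ae_sum_zeta (hW : IsWhiteNoise P W) (s : Finset ℕ) (c : ℕ → ℝ) :
    ∀ᵐ ω ∂P, W (∑ k ∈ s, c k • cosL2 k) ω = ∑ k ∈ s, c k * zeta W k ω :=
  hW.ae_sum s c cosL2

/-- At a grid point the sum is one Gaussian of standard deviation at most `√π √(2^j) b j`, and there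
are exponentially many pairs of truncation and grid point. Off the grid the Lipschitz bound and the
crude growth of `ζ_k` suffice. Truncated blocks (all `n ≤ 2^(j+1)`) are included so that all partial
sums, not only the dyadic ones, are controlled. -/
theorem ae_exists_block_abs_le (hW : IsWhiteNoise P W) {c : ℕ → ℝ → ℝ} {b : ℕ → ℝ}
    {p q K : ℝ} {A : ℕ} (hpq : p < q) (hA : 0 < A) (hK : 0 ≤ K) (hb : ∀ j, 0 < b j)
    (hc : ∀ j, ∀ k ∈ Finset.Ico (2 ^ j) (2 ^ (j + 1)), ∀ x ∈ Icc p q, |c k x| ≤ b j)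
    (hl : ∀ j, ∀ k ∈ Finset.Ico (2 ^ j) (2 ^ (j + 1)), ∀ x ∈ Icc p q, ∀ y ∈ Icc p q,
      |c k x - c k y| ≤ K * A ^ j * b j * |x - y|) :
    ∀ᵐ ω ∂P, ∃ C : ℝ, 0 ≤ C ∧ ∀ j : ℕ, ∀ n ≤ 2 ^ (j + 1), ∀ x ∈ Icc p q,
      |∑ k ∈ Finset.Ico (2 ^ j) n, c k x * zeta W k ω| ≤ C * ((j + 1) * √(2 ^ j) * b j) := by
  classical
  -- The factor `A ^ j` cancels the growth of the Lipschitz constant and `2 ^ j` cancels the number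
  -- of terms, so the discretization error is a multiple of `√(2^j) b j`.
  let N : ℕ → ℕ := fun j => (2 * A) ^ j
  have hN : ∀ j, 0 < N j := fun j => by positivity
  let pt : ℕ → ℕ → ℝ := fun j i => p + (q - p) * i / N j
  let I : ℕ → Finset (ℕ × ℕ) := fun j =>
    (Finset.range (2 ^ (j + 1) + 1) ×ˢ Finset.range (N j + 1)).filter
      fun a => pt j a.2 ∈ Icc p q
  let h : ℕ → ℕ × ℕ → L2 := fun j a =>
    ∑ k ∈ Finset.Ico (2 ^ j) a.1, c k (pt j a.2) • cosL2 k
  have hcard : ∀ j, ((I j).card : ℝ) ≤ 6 * ((4 * A : ℕ) : ℝ) ^ j := by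
    intro j
    have h1 : (I j).card ≤ (2 ^ (j + 1) + 1) * (N j + 1) := by
      refine (Finset.card_filter_le _ _).trans (le_of_eq ?_)
      simp
    have h2 : (2 ^ (j + 1) + 1) * (N j + 1) ≤ (3 * 2 ^ j) * (2 * N j) := by
      have := hN j
      have := Nat.one_le_two_pow (n := j)
      gcongr
      · rw [pow_succ]; omega
      · omega
    have h3 : (3 * 2 ^ j) * (2 * N j) = 6 * (4 * A) ^ j := by
      simp only [N]
      rw [show 4 * A = 2 * (2 * A) by ring, mul_pow 2 (2 * A)]
      ring
    exact_mod_cast (h1.trans h2).trans_eq h3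
  have hnorm : ∀ j, ∀ a ∈ I j, ‖h j a‖ ≤ √Real.pi * (√(2 ^ j) * b j) := by
    intro j a ha
    simp only [I, Finset.mem_filter, Finset.mem_product, Finset.mem_range] at ha
    refine abs_le_of_sq_le_sq' ?_ (by have := hb j; positivity) |>.2
    refine (norm_sq_sum_smul_cosL2_le _ _).trans ?_
    rw [mul_pow, mul_pow, Real.sq_sqrt Real.pi_pos.le, Real.sq_sqrt (by positivity)]
    gcongr
    calc ∑ k ∈ Finset.Ico (2 ^ j) a.1, c k (pt j a.2) ^ 2
        ≤ ∑ k ∈ Finset.Ico (2 ^ j) a.1, b j ^ 2 := by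
          refine Finset.sum_le_sum fun k hk => sq_le_sq.2 ?_
          rw [abs_of_pos (hb j)]
          rw [Finset.mem_Ico] at hk
          exact hc j k (Finset.mem_Ico.2 ⟨hk.1, by omega⟩) _ ha.2
      _ ≤ 2 ^ j * b j ^ 2 := by
          rw [Finset.sum_const, nsmul_eq_mul, Nat.card_Ico]
          gcongr
          have : a.1 - 2 ^ j ≤ 2 ^ j := by rw [pow_succ] at ha; omega
          exact_mod_cast this
  -- Linearity holds only almost surely for each combination; countably many combinations share one
  -- null set.
  have hall : ∀ᵐ ω ∂P, ∀ j, ∀ a : ℕ × ℕ, W (h j a) ω =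
      ∑ k ∈ Finset.Ico (2 ^ j) a.1, c k (pt j a.2) * zeta W k ω :=
    ae_all_iff.2 fun j => ae_all_iff.2 fun a => hW.ae_sum_zeta _ _
  filter_upwards [hall, hW.ae_exists_abs_zeta_le, hW.ae_exists_forall_abs_le I h
    (fun j => mul_pos (by positivity) (mul_pos (by positivity) (hb j))) hnorm (by positivity)
    hcard] with ω h1 ⟨Z, hZ, h2⟩ ⟨C, hC, h3⟩
  refine ⟨C * √Real.pi + K * (q - p) * Z * √2,
    add_nonneg (by positivity) (by have := sub_pos.2 hpq; positivity), fun j n hn x hx => ?_⟩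
  have hbj := hb j
  obtain ⟨i, hi, hi1, hi2⟩ := exists_grid_point hpq hx (hN j)
  have hmem : (n, i) ∈ I j := by
    simp only [I, Finset.mem_filter, Finset.mem_product, Finset.mem_range]
    exact ⟨⟨by omega, by omega⟩, hi1⟩
  have g1 := h3 j (n, i) hmem
  rw [h1 j (n, i)] at g1
  have g2 : |∑ k ∈ Finset.Ico (2 ^ j) n, c k x * zeta W k ω -
      ∑ k ∈ Finset.Ico (2 ^ j) n, c k (pt j i) * zeta W k ω| ≤
      K * (q - p) * Z * √2 * (√(2 ^ j) * b j) := by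
    rw [← Finset.sum_sub_distrib]
    refine (Finset.abs_sum_le_sum_abs _ _).trans ?_
    calc ∑ k ∈ Finset.Ico (2 ^ j) n, |c k x * zeta W k ω - c k (pt j i) * zeta W k ω|
        ≤ ∑ k ∈ Finset.Ico (2 ^ j) n,
            (K * A ^ j * b j * ((q - p) / N j)) * (Z * √(2 ^ (j + 1))) := by
          refine Finset.sum_le_sum fun k hk => ?_
          rw [Finset.mem_Ico] at hk
          rw [← sub_mul, abs_mul]
          have hk0 : k ≠ 0 := by have := Nat.one_le_two_pow (n := j); omega
          have hk2 : (k : ℝ) ≤ 2 ^ (j + 1) := by exact_mod_cast (hk.2.trans_le hn).le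
          gcongr
          · refine (hl j k (Finset.mem_Ico.2 ⟨hk.1, by omega⟩) x hx _ hi1).trans ?_
            gcongr
          · exact (h2 k hk0).trans (by gcongr)
      _ ≤ 2 ^ j * ((K * A ^ j * b j * ((q - p) / N j)) * (Z * √(2 ^ (j + 1)))) := by
          have hqp := sub_pos.2 hpq
          rw [Finset.sum_const, nsmul_eq_mul, Nat.card_Ico]
          gcongr
          have : n - 2 ^ j ≤ 2 ^ j := by rw [pow_succ] at hn; omega
          exact_mod_cast this
      _ = _ := by
          simp only [N]
          rw [pow_succ, Real.sqrt_mul (by positivity)]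
          push_cast
          rw [mul_pow]
          field_simp
  have g3 : √(2 ^ j) * b j ≤ ((j : ℝ) + 1) * √(2 ^ j) * b j := by
    have : 0 ≤ √(2 ^ j) * b j := by positivity
    nlinarith [mul_nonneg (Nat.cast_nonneg (α := ℝ) j) this]
  have g4 : K * (q - p) * Z * √2 * (√(2 ^ j) * b j) ≤
      K * (q - p) * Z * √2 * (((j : ℝ) + 1) * √(2 ^ j) * b j) := by
    have hqp := sub_pos.2 hpq
    gcongr
  have g5 := abs_sub_abs_le_abs_sub (∑ k ∈ Finset.Ico (2 ^ j) n, c k x * zeta W k ω)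
    (∑ k ∈ Finset.Ico (2 ^ j) n, c k (pt j i) * zeta W k ω)
  calc _ ≤ C * ((j + 1) * (√Real.pi * (√(2 ^ j) * b j))) +
      K * (q - p) * Z * √2 * (√(2 ^ j) * b j) := by linarith
    _ ≤ C * ((j + 1) * (√Real.pi * (√(2 ^ j) * b j))) +
      K * (q - p) * Z * √2 * (((j : ℝ) + 1) * √(2 ^ j) * b j) := by linarith
    _ = _ := by ring

end IsWhiteNoise

/-- Sums with dyadic blocks bounded by a summable sequence. -/
theorem abs_sum_Ico_two_pow_le {f : ℕ → ℝ} {B : ℕ → ℝ} (hB : Summable B)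
    (hf : ∀ j : ℕ, ∀ n ≤ 2 ^ (j + 1), |∑ k ∈ Finset.Ico (2 ^ j) n, f k| ≤ B j)
    (J n : ℕ) : |∑ k ∈ Finset.Ico (2 ^ J) n, f k| ≤ ∑' i, B (i + J) := by
  have hB0 : ∀ j, 0 ≤ B j := fun j => (abs_nonneg _).trans (hf j 0 (by positivity))
  have hBJ : Summable fun i => B (i + J) := (summable_nat_add_iff J).2 hB
  have key : ∀ i : ℕ, ∀ n ≤ 2 ^ (J + i + 1),
      |∑ k ∈ Finset.Ico (2 ^ J) n, f k| ≤ ∑ l ∈ Finset.range (i + 1), B (l + J) := by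
    intro i
    induction i with
    | zero => intro n hn; simpa using hf J n hn
    | succ i ih =>
      intro n hn
      rcases le_total n (2 ^ (J + i + 1)) with h | h
      · refine (ih n h).trans ?_
        rw [Finset.sum_range_succ _ (i + 1)]
        linarith [hB0 (i + 1 + J)]
      · rw [← Finset.sum_Ico_consecutive f (Nat.pow_le_pow_right two_pos (by omega)) h,
          Finset.sum_range_succ _ (i + 1)]
        refine (abs_add_le _ _).trans (add_le_add (ih _ le_rfl) ?_)
        rw [show i + 1 + J = J + i + 1 by ring]
        exact hf (J + i + 1) n hn
  -- Since `n < 2 ^ n`, going `n` levels beyond `J` certainly covers the range of summation.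
  refine (key n n ?_).trans (hBJ.sum_le_tsum _ fun i _ => hB0 _)
  exact Nat.lt_two_pow_self.le.trans (Nat.pow_le_pow_right two_pos (by omega))

/-- Interpolation between the bounds of a function and of its derivative. -/
theorem abs_sub_le_rpow_of_bounds {F F' : ℝ → ℝ} {p q a b γ : ℝ} (ha : 0 ≤ a)
    (hb : 0 ≤ b) (hγ : 0 ≤ γ) (hγ1 : γ ≤ 1) (hF : ∀ x ∈ Icc p q, |F x| ≤ a)
    (hd : ∀ x ∈ Icc p q, HasDerivAt F (F' x) x) (hF' : ∀ x ∈ Icc p q, |F' x| ≤ b)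
    {x y : ℝ} (hx : x ∈ Icc p q) (hy : y ∈ Icc p q) :
    |F x - F y| ≤ 2 * (a ^ (1 - γ) * b ^ γ) * |x - y| ^ γ := by
  have h1 : |F x - F y| ≤ 2 * a := by
    refine (abs_sub _ _).trans ?_
    linarith [hF x hx, hF y hy]
  have h2 : |F x - F y| ≤ b * |x - y| := by
    have := (convex_Icc p q).norm_image_sub_le_of_norm_hasDerivWithin_le
      (fun z hz => (hd z hz).hasDerivWithinAt) (fun z hz => hF' z hz) hy hx
    simpa using this
  calc |F x - F y| = |F x - F y| ^ (1 - γ) * |F x - F y| ^ γ := by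
        rw [← Real.rpow_add_of_nonneg (abs_nonneg _) (by linarith) hγ]; simp
    _ ≤ (2 * a) ^ (1 - γ) * (b * |x - y|) ^ γ := by
        gcongr
    _ = 2 ^ (1 - γ) * (a ^ (1 - γ) * b ^ γ) * |x - y| ^ γ := by
        rw [Real.mul_rpow two_pos.le ha, Real.mul_rpow hb (abs_nonneg _)]; ring
    _ ≤ _ := by
        gcongr
        calc (2 : ℝ) ^ (1 - γ) ≤ 2 ^ (1 : ℝ) :=
              Real.rpow_le_rpow_of_exponent_le one_le_two (by linarith)
          _ = 2 := Real.rpow_one 2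

end

/-! ### Hölder bounds for random series by summing over blocks -/

section

variable {Ω : Type*} [MeasurableSpace Ω] {P : Measure Ω} {W : L2 → Ω → ℝ}

theorem summable_add_one_mul_geometric {r : ℝ} (h0 : 0 ≤ r) (h1 : r < 1) :
    Summable fun j : ℕ => ((j : ℝ) + 1) * r ^ j := by
  have hr : ‖r‖ < 1 := by rwa [Real.norm_of_nonneg h0]
  simpa [add_mul] using (summable_pow_mul_geometric_of_norm_lt_one 1 hr).add
    (summable_geometric_of_lt_one h0 h1)

theorem natCast_pow_inv_le {j k : ℕ} (hk : 2 ^ j ≤ k) (a : ℕ) :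
    ((k : ℝ) ^ a)⁻¹ ≤ (2 : ℝ) ^ (-(a * j) : ℝ) := by
  have e : (2 : ℝ) ^ (-(a * j) : ℝ) = (((2 : ℝ) ^ j) ^ a)⁻¹ := by
    rw [Real.rpow_neg two_pos.le, ← pow_mul, ← Real.rpow_natCast]
    push_cast
    rw [mul_comm]
  rw [e]
  have : (2 : ℝ) ^ j ≤ k := by exact_mod_cast hk
  gcongr

theorem natCast_pow_le {j k : ℕ} (hk : k ≤ 2 ^ (j + 1)) (m : ℕ) :
    (k : ℝ) ^ m ≤ (2 : ℝ) ^ (m + m * j : ℝ) := by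
  have e : (2 : ℝ) ^ (m + m * j : ℝ) = ((2 : ℝ) ^ (j + 1)) ^ m := by
    rw [← pow_mul, ← Real.rpow_natCast]
    push_cast
    ring_nf
  rw [e]
  have : (k : ℝ) ≤ 2 ^ (j + 1) := by exact_mod_cast hk
  gcongr

/-- Hölder regularity, uniformly in the number of dyadic blocks, of a random series whose
coefficients and their derivatives have polynomial size. -/
theorem IsWhiteNoise.ae_exists_holder_partial_sums (hW : IsWhiteNoise P W) {c c' : ℕ → ℝ → ℝ}
    {p q : ℝ} {a m : ℕ} (hpq : p < q)
    (hc : ∀ k ≠ 0, ∀ x ∈ Icc p q, |c k x| ≤ ((k : ℝ) ^ a)⁻¹)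
    (hd : ∀ k, ∀ x ∈ Icc p q, HasDerivAt (c k) (c' k x) x)
    (hc' : ∀ k ≠ 0, ∀ x ∈ Icc p q, |c' k x| ≤ ((k : ℝ) ^ a)⁻¹ * k ^ m)
    (hl : ∀ k ≠ 0, ∀ x ∈ Icc p q, ∀ y ∈ Icc p q,
      |c' k x - c' k y| ≤ ((k : ℝ) ^ a)⁻¹ * k ^ (2 * m) * |x - y|) :
    ∀ᵐ ω ∂P, ∀ γ : ℝ, 0 ≤ γ → γ ≤ 1 → γ * m + 1 / 2 < a → ∃ C : ℝ, 0 ≤ C ∧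
      ∀ N : ℕ, ∀ x ∈ Icc p q, ∀ y ∈ Icc p q,
        |∑ k ∈ Finset.Ico 1 (2 ^ N), c k x * zeta W k ω -
          ∑ k ∈ Finset.Ico 1 (2 ^ N), c k y * zeta W k ω| ≤ C * |x - y| ^ γ := by
  let b : ℕ → ℝ := fun j => (2 : ℝ) ^ (-(a * j) : ℝ)
  let b' : ℕ → ℝ := fun j => b j * (2 : ℝ) ^ (m + m * j : ℝ)
  have hb : ∀ j, 0 < b j := fun j => by positivity
  have hb' : ∀ j, 0 < b' j := fun j => by positivity
  have hk0 : ∀ j : ℕ, ∀ k ∈ Finset.Ico (2 ^ j) (2 ^ (j + 1)), k ≠ 0 := fun j k hk => by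
    have := (Finset.mem_Ico.1 hk).1
    have := Nat.one_le_two_pow (n := j)
    omega
  have hbb : ∀ j k : ℕ, k ∈ Finset.Ico (2 ^ j) (2 ^ (j + 1)) → ((k : ℝ) ^ a)⁻¹ ≤ b j :=
    fun j k hk => natCast_pow_inv_le (Finset.mem_Ico.1 hk).1 a
  have hmm : ∀ j k : ℕ, k ∈ Finset.Ico (2 ^ j) (2 ^ (j + 1)) →
      (k : ℝ) ^ m ≤ (2 : ℝ) ^ (m + m * j : ℝ) :=
    fun j k hk => natCast_pow_le (Finset.mem_Ico.1 hk).2.le m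
  have h2m : ∀ j : ℕ, (2 : ℝ) ^ (m + m * j : ℝ) = 2 ^ m * (((2 ^ m : ℕ) : ℝ)) ^ j := by
    intro j
    rw [Real.rpow_add two_pos, Real.rpow_natCast, Real.rpow_mul two_pos.le, Real.rpow_natCast,
      Real.rpow_natCast]
    push_cast
    rfl
  have H1 := hW.ae_exists_block_abs_le (c := c) (b := b) (K := 2 ^ m) (A := 2 ^ m) hpq
    (by positivity) (by positivity) hb
    (fun j k hk x hx => (hc k (hk0 j k hk) x hx).trans (hbb j k hk))
    (fun j k hk x hx y hy => by
      have := (convex_Icc p q).norm_image_sub_le_of_norm_hasDerivWithin_le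
        (fun z hz => (hd k z hz).hasDerivWithinAt)
        (fun z hz => hc' k (hk0 j k hk) z hz) hy hx
      refine (by simpa using this : |c k x - c k y| ≤ _).trans ?_
      rw [← h2m, mul_comm ((2 : ℝ) ^ (m + m * j : ℝ))]
      have := hbb j k hk
      have := hmm j k hk
      have := (hb j).le
      gcongr)
  have H2 := hW.ae_exists_block_abs_le (c := c') (b := b') (K := 2 ^ m) (A := 2 ^ m) hpq
    (by positivity) (by positivity) hb'
    (fun j k hk x hx => (hc' k (hk0 j k hk) x hx).trans (by
      have := hbb j k hk
      have := hmm j k hk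
      have := (hb j).le
      simp only [b']
      gcongr))
    (fun j k hk x hx y hy => by
      refine (hl k (hk0 j k hk) x hx y hy).trans ?_
      have h1 := hbb j k hk
      have h2 := hmm j k hk
      have h3 := (hb j).le
      have e : 2 ^ m * (((2 ^ m : ℕ) : ℝ)) ^ j * b' j =
          b j * ((2 : ℝ) ^ (m + m * j : ℝ) * (2 : ℝ) ^ (m + m * j : ℝ)) := by
        rw [← h2m]; ring
      rw [e, two_mul, pow_add]
      gcongr)
  filter_upwards [H1, H2] with ω ⟨C₁, hC₁, h1⟩ ⟨C₂, hC₂, h2⟩ γ hγ hγ1 hγa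
  -- Interpolated growth ratio of the blocks: `1/2` from the Gaussian sum, `-a` from the
  -- coefficients, `m γ` from the derivative. The hypothesis on `γ` says exactly that `r < 1`.
  let r : ℝ := (2 : ℝ) ^ (1 / 2 - a + m * γ : ℝ)
  have hr0 : 0 ≤ r := by positivity
  have hr1 : r < 1 := Real.rpow_lt_one_of_one_lt_of_neg one_lt_two (by linarith)
  let B : ℕ → ℝ := fun j => ((j : ℝ) + 1) * r ^ j
  have hB : Summable B := summable_add_one_mul_geometric hr0 hr1
  let D : ℝ := 2 * (C₁ ^ (1 - γ) * C₂ ^ γ * 2 ^ (m * γ))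
  have hblock : ∀ j, ∀ x ∈ Icc p q, ∀ y ∈ Icc p q,
      |∑ k ∈ Finset.Ico (2 ^ j) (2 ^ (j + 1)), c k x * zeta W k ω -
        ∑ k ∈ Finset.Ico (2 ^ j) (2 ^ (j + 1)), c k y * zeta W k ω| ≤
        D * B j * |x - y| ^ γ := by
    intro j x hx y hy
    have hbj := (hb j).le
    have hbj' := (hb' j).le
    have := abs_sub_le_rpow_of_bounds (γ := γ)
      (F := fun x => ∑ k ∈ Finset.Ico (2 ^ j) (2 ^ (j + 1)), c k x * zeta W k ω)
      (F' := fun x => ∑ k ∈ Finset.Ico (2 ^ j) (2 ^ (j + 1)), c' k x * zeta W k ω)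
      (by positivity) (by positivity) hγ hγ1 (h1 j _ le_rfl)
      (fun x hx => HasDerivAt.fun_sum fun k _ => (hd k x hx).mul_const _) (h2 j _ le_rfl) hx hy
    refine this.trans (le_of_eq ?_)
    congr 1
    rw [Real.mul_rpow hC₁ (by positivity), Real.mul_rpow hC₂ (by positivity),
      Real.mul_rpow (by positivity) hbj, Real.mul_rpow (by positivity) hbj']
    have e1 : (((j : ℝ) + 1) * √(2 ^ j)) ^ (1 - γ) * (((j : ℝ) + 1) * √(2 ^ j)) ^ γ =
        ((j : ℝ) + 1) * √(2 ^ j) := by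
      rw [← Real.rpow_add (by positivity)]; simp
    have e2 : √(2 ^ j) * (b j ^ (1 - γ) * b' j ^ γ) = 2 ^ (m * γ) * r ^ j := by
      simp only [b', b, r]
      rw [Real.sqrt_eq_rpow, ← Real.rpow_natCast, ← Real.rpow_natCast, ← Real.rpow_add two_pos,
        ← Real.rpow_mul two_pos.le, ← Real.rpow_mul two_pos.le, ← Real.rpow_mul two_pos.le,
        ← Real.rpow_mul two_pos.le, ← Real.rpow_add two_pos, ← Real.rpow_add two_pos,
        ← Real.rpow_add two_pos]
      congr 1
      ring
    simp only [D, B]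
    linear_combination 2 * C₁ ^ (1 - γ) * C₂ ^ γ * b j ^ (1 - γ) * b' j ^ γ * e1 +
      2 * C₁ ^ (1 - γ) * C₂ ^ γ * (j + 1) * e2
  have hD : 0 ≤ D := by positivity
  have hB0 : ∀ j, 0 ≤ B j := fun j => by positivity
  refine ⟨D * ∑' j, B j, mul_nonneg hD (tsum_nonneg hB0), fun N x hx y hy => ?_⟩
  have hN : |∑ k ∈ Finset.Ico 1 (2 ^ N), c k x * zeta W k ω -
      ∑ k ∈ Finset.Ico 1 (2 ^ N), c k y * zeta W k ω| ≤
      D * (∑ j ∈ Finset.range N, B j) * |x - y| ^ γ := by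
    induction N with
    | zero => simp
    | succ N ih =>
      have h2N : 2 ^ N ≤ 2 ^ (N + 1) := Nat.pow_le_pow_right two_pos (by omega)
      rw [← Finset.sum_Ico_consecutive _ Nat.one_le_two_pow h2N,
        ← Finset.sum_Ico_consecutive _ Nat.one_le_two_pow h2N, Finset.sum_range_succ,
        add_sub_add_comm, mul_add, add_mul]
      exact (abs_add_le _ _).trans (add_le_add ih (hblock N x hx y hy))
  refine hN.trans ?_
  gcongr
  exact hB.sum_le_tsum _ fun i _ => hB0 i

end

/-! ### Convergence of the series for `U` and `U_x` -/

section

variable {Ω : Type*} {W : L2 → Ω → ℝ}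

theorem exp_neg_sq_mul_le_one {t : ℝ} (ht : 0 ≤ t) (k : ℕ) :
    Real.exp (-(k : ℝ) ^ 2 * t) ≤ 1 := by
  rw [Real.exp_le_one_iff, neg_mul, neg_nonpos]
  positivity

theorem abs_one_sub_exp_le_one {t : ℝ} (ht : 0 ≤ t) (k : ℕ) :
    |1 - Real.exp (-(k : ℝ) ^ 2 * t)| ≤ 1 := by
  have := exp_neg_sq_mul_le_one ht k
  have := Real.exp_pos (-(k : ℝ) ^ 2 * t)
  rw [abs_le]; constructor <;> linarith

theorem abs_exp_sub_exp_le {a b : ℝ} (ha : a ≤ 0) (hb : b ≤ 0) :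
    |Real.exp a - Real.exp b| ≤ |a - b| := by
  have := (convex_Iic (0 : ℝ)).norm_image_sub_le_of_norm_hasDerivWithin_le (C := 1)
    (fun z _ => (Real.hasDerivAt_exp z).hasDerivWithinAt)
    (fun z hz => by rw [Real.norm_of_nonneg (Real.exp_pos z).le]; exact Real.exp_le_one_iff.2 hz)
    hb ha
  simpa using this

theorem summable_mul_rpow_inv (Z : ℝ) :
    Summable fun k : ℕ => Z * (((k + 1 : ℕ) : ℝ) ^ (3 / 2 : ℝ))⁻¹ := by
  refine Summable.mul_left _ ?_
  exact (summable_nat_add_iff 1).2 (Real.summable_nat_rpow_inv.2 (by norm_num))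

theorem sq_inv_mul_sqrt {k : ℕ} (hk : k ≠ 0) :
    ((k : ℝ) ^ 2)⁻¹ * √k = ((k : ℝ) ^ (3 / 2 : ℝ))⁻¹ := by
  have hk' : (0 : ℝ) < k := by exact_mod_cast Nat.pos_of_ne_zero hk
  rw [Real.sqrt_eq_rpow, ← Real.rpow_natCast, ← Real.rpow_neg hk'.le, ← Real.rpow_neg hk'.le,
    ← Real.rpow_add hk']
  norm_num

/-- The majorant does not depend on `t` or `x`, so it yields absolute convergence, joint continuity
and termwise integration on a single event. -/
theorem abs_uTerm_le {ω : Ω} {Z : ℝ} (hz : ∀ k : ℕ, k ≠ 0 → |zeta W k ω| ≤ Z * √k)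
    {t : ℝ} (ht : 0 ≤ t) (x : ℝ) (k : ℕ) :
    |uTerm W t x ω (k + 1)| ≤ Z * (((k + 1 : ℕ) : ℝ) ^ (3 / 2 : ℝ))⁻¹ := by
  rw [← sq_inv_mul_sqrt (Nat.succ_ne_zero k), uTerm, abs_mul, abs_mul, abs_mul, abs_inv,
    abs_of_nonneg (by positivity : (0 : ℝ) ≤ ((k + 1 : ℕ) : ℝ) ^ 2)]
  calc _ ≤ (((k + 1 : ℕ) : ℝ) ^ 2)⁻¹ * 1 * 1 * (Z * √(k + 1 : ℕ)) := by
        gcongr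
        · exact abs_one_sub_exp_le_one ht (k + 1)
        · exact Real.abs_cos_le_one _
        · exact hz (k + 1) (Nat.succ_ne_zero k)
    _ = _ := by ring

theorem summable_uTerm {ω : Ω} {Z : ℝ}
    (hz : ∀ k : ℕ, k ≠ 0 → |zeta W k ω| ≤ Z * √k) {t : ℝ} (ht : 0 ≤ t) (x : ℝ) :
    Summable fun k : ℕ => uTerm W t x ω (k + 1) :=
  Summable.of_norm_bounded (summable_mul_rpow_inv Z) fun k => abs_uTerm_le hz ht x k

theorem continuousOn_U {ω : Ω} {Z : ℝ}
    (hz : ∀ k : ℕ, k ≠ 0 → |zeta W k ω| ≤ Z * √k) :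
    ContinuousOn (fun z : ℝ × ℝ => U W z.1 z.2 ω) (Ici 0 ×ˢ univ) := by
  unfold U
  refine ContinuousOn.add (by fun_prop) (ContinuousOn.mul continuousOn_const ?_)
  refine continuousOn_tsum (fun k => ?_) (summable_mul_rpow_inv Z)
    fun k z hz' => abs_uTerm_le hz hz'.1 z.2 k
  unfold uTerm
  fun_prop

theorem U_zero (x : ℝ) (ω : Ω) : U W 0 x ω = 0 := by
  simp [U, uTerm]

theorem sum_range_succ_eq_sum_Ico (f : ℕ → ℝ) (N : ℕ) :
    ∑ k ∈ Finset.range N, f (k + 1) = ∑ k ∈ Finset.Ico 1 (N + 1), f k := by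
  rw [Finset.sum_Ico_eq_sum_range]
  simp [add_comm]

/-- Any partial sum reaching past `2 ^ J` differs from the dyadic one by at most the tail of `∑ B`
from `J`, so the partial sums are uniformly Cauchy. -/
theorem exists_tendstoUniformlyOn_of_block_bounds {f : ℕ → ℝ → ℝ} {s : Set ℝ} {B : ℕ → ℝ}
    (hB : Summable B)
    (hf : ∀ j : ℕ, ∀ n ≤ 2 ^ (j + 1), ∀ x ∈ s, |∑ k ∈ Finset.Ico (2 ^ j) n, f k x| ≤ B j) :
    ∃ g : ℝ → ℝ,
      TendstoUniformlyOn (fun N x => ∑ k ∈ Finset.range N, f (k + 1) x) g atTop s := by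
  have hlim : Tendsto (fun J => ∑' i, B (i + J)) atTop (𝓝 0) := tendsto_sum_nat_add B
  have hc : UniformCauchySeqOn (fun N x => ∑ k ∈ Finset.range N, f (k + 1) x) atTop s := by
    rw [Metric.uniformCauchySeqOn_iff]
    intro ε hε
    obtain ⟨J, hJ⟩ := (hlim.eventually (gt_mem_nhds (half_pos hε))).exists
    have key : ∀ m ≥ 2 ^ J, ∀ x ∈ s, |∑ k ∈ Finset.range m, f (k + 1) x -
        ∑ k ∈ Finset.Ico 1 (2 ^ J), f k x| < ε / 2 := by
      intro m hm x hx
      rw [sum_range_succ_eq_sum_Ico fun k => f k x,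
        ← Finset.sum_Ico_consecutive _ Nat.one_le_two_pow (hm.le.trans (Nat.le_succ m)),
        add_sub_cancel_left]
      exact (abs_sum_Ico_two_pow_le hB (fun j n hn => hf j n hn x hx) J _).trans_lt hJ
    refine ⟨2 ^ J, fun m hm n hn x hx => ?_⟩
    rw [Real.dist_eq]
    have h1 := abs_lt.1 (key m hm x hx)
    have h2 := abs_lt.1 (key n hn x hx)
    rw [abs_lt]
    constructor <;> linarith
  have hp : ∀ x, ∃ y, x ∈ s →
      Tendsto (fun N => ∑ k ∈ Finset.range N, f (k + 1) x) atTop (𝓝 y) := by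
    intro x
    by_cases hx : x ∈ s
    · obtain ⟨y, hy⟩ := cauchySeq_tendsto_of_complete (hc.cauchySeq hx)
      exact ⟨y, fun _ => hy⟩
    · exact ⟨0, fun h => absurd h hx⟩
  choose g hg using hp
  exact ⟨g, hc.tendstoUniformlyOn_of_tendsto hg⟩

/-- The part of the differentiated series containing the exponentials. -/
theorem exists_tendstoUniformlyOn_exp_part {z : ℕ → ℝ} {Z : ℝ} (hZ : 0 ≤ Z)
    (hz : ∀ k : ℕ, k ≠ 0 → |z k| ≤ Z * √k) {t : ℝ} (ht : 0 < t) (s : Set ℝ) :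
    ∃ g : ℝ → ℝ, TendstoUniformlyOn (fun N x => ∑ k ∈ Finset.range N,
      (((k + 1 : ℕ) : ℝ)⁻¹ * Real.exp (-((k + 1 : ℕ) : ℝ) ^ 2 * t) *
        Real.sin ((k + 1 : ℕ) * x) * z (k + 1))) g atTop s := by
  refine ⟨_, tendstoUniformlyOn_tsum_nat (u := fun k : ℕ => Z * Real.exp (k * (-t)))
    ((Real.summable_exp_nat_mul_iff.2 (by linarith)).mul_left Z) fun k x _ => ?_⟩
  have hk1 : (1 : ℝ) ≤ ((k + 1 : ℕ) : ℝ) := by exact_mod_cast Nat.succ_le_succ (Nat.zero_le k)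
  rw [Real.norm_eq_abs, abs_mul, abs_mul, abs_mul, abs_inv, Real.abs_exp, Nat.abs_cast]
  have h1 : √((k + 1 : ℕ) : ℝ) ≤ ((k + 1 : ℕ) : ℝ) :=
    Real.sqrt_le_iff.2 ⟨by positivity, by nlinarith⟩
  have h2 : Real.exp (-((k + 1 : ℕ) : ℝ) ^ 2 * t) ≤ Real.exp (k * (-t)) := by
    refine Real.exp_le_exp.2 ?_
    have : (k : ℝ) ≤ ((k + 1 : ℕ) : ℝ) ^ 2 := by
      push_cast
      nlinarith [Nat.cast_nonneg (α := ℝ) k]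
    nlinarith
  calc _ ≤ (((k + 1 : ℕ) : ℝ))⁻¹ * Real.exp (k * (-t)) * 1 * (Z * ((k + 1 : ℕ) : ℝ)) := by
        gcongr
        · exact Real.abs_sin_le_one _
        · exact (hz _ (Nat.succ_ne_zero k)).trans (by gcongr)
    _ = _ := by
        have : ((k + 1 : ℕ) : ℝ) ≠ 0 := by positivity
        field_simp

theorem hasDerivAt_uTerm (t x : ℝ) (ω : Ω) {k : ℕ} (hk : k ≠ 0) :
    HasDerivAt (fun y => uTerm W t y ω k) (-uxTerm W t x ω k) x := by
  have hk' : (k : ℝ) ≠ 0 := by exact_mod_cast hk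
  unfold uTerm uxTerm
  have h1 : HasDerivAt (fun y : ℝ => Real.cos (k * y)) (-Real.sin (k * x) * k) x := by
    simpa using ((hasDerivAt_id x).const_mul (k : ℝ)).cos
  refine ((h1.const_mul _).mul_const _).congr_deriv ?_
  field_simp

/-- Splitting `1 - exp (-k² t)` separates `∑ k⁻¹ sin (kx) ζ_k`, handled by block bounds and free of
`t`, from an exponentially damped series converging absolutely for `t > 0`. One null set therefore
serves all `t`. The open interval `(-4, 4)` contains `[0, π]`, so the derivatives are two-sided even
at the end points. -/
theorem IsWhiteNoise.ae_hasDerivAt_U [MeasurableSpace Ω] {P : Measure Ω}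
    (hW : IsWhiteNoise P W) :
    ∀ᵐ ω ∂P, ∀ t : ℝ, 0 < t → ∃ g : ℝ → ℝ, ContinuousOn g (Ioo (-4) 4) ∧
      ∀ x ∈ Ioo (-4 : ℝ) 4, HasDerivAt (fun y => U W t y ω) (g x) x ∧
        Tendsto (fun N : ℕ => -(2 / Real.pi) * ∑ k ∈ Finset.range N, uxTerm W t x ω (k + 1))
          atTop (𝓝 (g x)) := by
  have hk1 : ∀ j k : ℕ, k ∈ Finset.Ico (2 ^ j) (2 ^ (j + 1)) → (2 : ℝ) ^ j ≤ k := fun j k hk => by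
    exact_mod_cast (Finset.mem_Ico.1 hk).1
  have hb : ∀ j k : ℕ, k ∈ Finset.Ico (2 ^ j) (2 ^ (j + 1)) →
      (k : ℝ)⁻¹ ≤ ((2 : ℝ) ^ j)⁻¹ := fun j k hk => by
    have := hk1 j k hk
    gcongr
  filter_upwards [hW.ae_exists_abs_zeta_le, hW.ae_exists_block_abs_le
    (c := fun k x => (k : ℝ)⁻¹ * Real.sin (k * x)) (b := fun j => ((2 : ℝ) ^ j)⁻¹)
    (p := -4) (q := 4) (K := 1) (A := 2) (by norm_num) two_pos zero_le_one
    (fun j => by positivity)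
    (fun j k hk x _ => by
      rw [abs_mul, abs_inv, Nat.abs_cast]
      calc _ ≤ ((2 : ℝ) ^ j)⁻¹ * 1 := by
            gcongr
            · exact hk1 j k hk
            · exact Real.abs_sin_le_one _
        _ = _ := mul_one _)
    (fun j k hk x _ y _ => by
      have hk0 : (0 : ℝ) < k := (by positivity : (0 : ℝ) < 2 ^ j).trans_le (hk1 j k hk)
      rw [← mul_sub, abs_mul, abs_inv, Nat.abs_cast]
      have h2 : |Real.sin (k * x) - Real.sin (k * y)| ≤ k * |x - y| := by
        have := Real.lipschitzWith_sin.dist_le_mul (k * x) (k * y)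
        rw [Real.dist_eq, Real.dist_eq, ← mul_sub, abs_mul, Nat.abs_cast] at this
        simpa using this
      calc _ ≤ (k : ℝ)⁻¹ * (k * |x - y|) := by gcongr
        _ = _ := by push_cast; field_simp)] with ω ⟨Z, hZ, hz⟩ ⟨C, hC, h⟩ t ht
  have hB : Summable fun j : ℕ => C * (((j : ℝ) + 1) * √(2 ^ j) * ((2 : ℝ) ^ j)⁻¹) := by
    refine Summable.mul_left _ ?_
    refine (summable_add_one_mul_geometric (r := (√2)⁻¹) (by positivity) ?_).congr fun j => ?_
    · exact inv_lt_one_of_one_lt₀ (by rw [Real.lt_sqrt] <;> norm_num)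
    · rw [mul_assoc]
      congr 1
      have h2 : √((2 : ℝ) ^ j) = √2 ^ j := by
        rw [Real.sqrt_eq_rpow, Real.sqrt_eq_rpow, ← Real.rpow_natCast, ← Real.rpow_mul two_pos.le,
          ← Real.rpow_natCast, ← Real.rpow_mul two_pos.le, mul_comm]
      have h3 : (2 : ℝ) ^ j = √2 ^ j * √2 ^ j := by
        rw [← mul_pow, Real.mul_self_sqrt two_pos.le]
      rw [h2, h3, inv_pow]
      field_simp
  obtain ⟨g₁, hg₁⟩ := exists_tendstoUniformlyOn_of_block_bounds hB
    (fun j n hn x hx => h j n hn x (Ioo_subset_Icc_self hx))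
  obtain ⟨g₂, hg₂⟩ := exists_tendstoUniformlyOn_exp_part hZ hz ht (Ioo (-4) 4)
  have hu : TendstoUniformlyOn
      (fun N x => -(2 / Real.pi) * ∑ k ∈ Finset.range N, uxTerm W t x ω (k + 1))
      (fun x => -(2 / Real.pi) * (g₁ x - g₂ x)) atTop (Ioo (-4) 4) := by
    refine ((uniformContinuous_const_smul (-(2 / Real.pi))).comp_tendstoUniformlyOn
      (hg₁.sub hg₂)).congr ?_
    refine Eventually.of_forall fun N x _ => ?_
    simp only [Function.comp, Pi.sub_apply, smul_eq_mul]
    rw [← Finset.sum_sub_distrib]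
    congr 1
    refine Finset.sum_congr rfl fun k _ => ?_
    unfold uxTerm
    ring
  refine ⟨_, hu.continuousOn (Frequently.of_forall fun N => ?_), fun x hx =>
    ⟨?_, hu.tendsto_at hx⟩⟩
  · unfold uxTerm
    fun_prop
  · refine hasDerivAt_of_tendstoUniformlyOn isOpen_Ioo hu (f := fun N x => t / Real.pi *
      zeta W 0 ω + 2 / Real.pi * ∑ k ∈ Finset.range N, uTerm W t x ω (k + 1))
      (Eventually.of_forall fun N x _ => ?_) (fun x _ => ?_) hx
    · refine (((HasDerivAt.fun_sum fun k _ =>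
        hasDerivAt_uTerm t x ω (Nat.succ_ne_zero k)).const_mul _).const_add _).congr_deriv ?_
      rw [Finset.sum_neg_distrib]
      ring
    · exact ((summable_uTerm hz ht.le x).hasSum.tendsto_sum_nat.const_mul _).const_add _

theorem Icc_zero_pi_subset_Ioo : Icc 0 Real.pi ⊆ Ioo (-4 : ℝ) 4 := fun x hx =>
  ⟨by linarith [hx.1], by linarith [hx.2, Real.pi_lt_four]⟩

theorem spaceDeriv_eq_of_hasDerivAt {u : ℝ → ℝ → Ω → ℝ} {t x d : ℝ} {ω : Ω}
    (hx : x ∈ Icc 0 Real.pi) (h : HasDerivAt (fun y => u t y ω) d x) :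
    spaceDeriv u t x ω = d :=
  h.hasDerivWithinAt.derivWithin (uniqueDiffOn_Icc Real.pi_pos x hx)

theorem IsWhiteNoise.ae_tendsto_spaceDeriv [MeasurableSpace Ω] {P : Measure Ω}
    (hW : IsWhiteNoise P W) :
    ∀ᵐ ω ∂P, ∀ t : ℝ, 0 < t → ∀ x ∈ Icc 0 Real.pi,
      HasDerivAt (fun y => U W t y ω) (spaceDeriv (U W) t x ω) x ∧
      Tendsto (fun N : ℕ => -(2 / Real.pi) * ∑ k ∈ Finset.range N, uxTerm W t x ω (k + 1))
        atTop (𝓝 (spaceDeriv (U W) t x ω)) := by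
  filter_upwards [hW.ae_hasDerivAt_U] with ω h t ht x hx
  obtain ⟨g, -, hg⟩ := h t ht
  have := hg x (Icc_zero_pi_subset_Ioo hx)
  rwa [spaceDeriv_eq_of_hasDerivAt hx this.1]

theorem IsWhiteNoise.ae_contDiffOn_U [MeasurableSpace Ω] {P : Measure Ω}
    (hW : IsWhiteNoise P W) :
    ∀ᵐ ω ∂P, ∀ t : ℝ, 0 < t → ContDiffOn ℝ 1 (fun x => U W t x ω) (Icc 0 Real.pi) := by
  filter_upwards [hW.ae_hasDerivAt_U] with ω h t ht
  obtain ⟨g, hg, hd⟩ := h t ht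
  have : ContDiffOn ℝ (0 + 1) (fun x => U W t x ω) (Icc 0 Real.pi) := by
    rw [contDiffOn_succ_iff_derivWithin (uniqueDiffOn_Icc Real.pi_pos)]
    refine ⟨fun x hx => (hd x (Icc_zero_pi_subset_Ioo hx)).1.differentiableAt
      |>.differentiableWithinAt, by simp, ?_⟩
    rw [contDiffOn_zero]
    refine (hg.mono Icc_zero_pi_subset_Ioo).congr fun x hx => ?_
    exact spaceDeriv_eq_of_hasDerivAt hx (hd x (Icc_zero_pi_subset_Ioo hx)).1
  simpa using this

theorem holderOnWith_of_abs_sub_le {f : ℝ → ℝ} {s : Set ℝ} {C γ : ℝ} (hγ : 0 ≤ γ)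
    (h : ∀ x ∈ s, ∀ y ∈ s, |f x - f y| ≤ C * |x - y| ^ γ) :
    HolderOnWith C.toNNReal γ.toNNReal f s := by
  intro x hx y hy
  have hC : C * |x - y| ^ γ ≤ C.toNNReal * |x - y| ^ γ := by
    gcongr
    exact Real.le_coe_toNNReal C
  rw [edist_dist, edist_dist, Real.coe_toNNReal _ hγ, ENNReal.ofReal_rpow_of_nonneg dist_nonneg hγ,
    ← ENNReal.ofReal_coe_nnreal, ← ENNReal.ofReal_mul (by positivity)]
  exact ENNReal.ofReal_le_ofReal ((h x hx y hy).trans hC)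

theorem abs_sub_le_of_lipschitz {f : ℝ → ℝ} {s : Set ℝ} {C D γ : ℝ} (hC : 0 ≤ C) (hγ : 0 ≤ γ)
    (hγ1 : γ ≤ 1) (hs : ∀ x ∈ s, ∀ y ∈ s, |x - y| ≤ D)
    (h : ∀ x ∈ s, ∀ y ∈ s, |f x - f y| ≤ C * |x - y|) :
    ∀ x ∈ s, ∀ y ∈ s, |f x - f y| ≤ (C * D ^ (1 - γ)) * |x - y| ^ γ := by
  intro x hx y hy
  refine (h x hx y hy).trans ?_
  rw [mul_assoc]
  gcongr
  calc |x - y| = |x - y| ^ (1 - γ) * |x - y| ^ γ := by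
        rw [← Real.rpow_add_of_nonneg (abs_nonneg _) (by linarith) hγ]; simp
    _ ≤ _ := by
        gcongr
        exact hs x hx y hy

/-- A Hölder bound uniform in the number of blocks survives a pointwise limit. -/
theorem abs_sub_le_of_tendsto {f : ℕ → ℝ → ℝ} {g : ℝ → ℝ} {p q C γ : ℝ} {s : Set ℝ}
    (hs : s ⊆ Icc p q)
    (h : ∀ N : ℕ, ∀ x ∈ Icc p q, ∀ y ∈ Icc p q, |∑ k ∈ Finset.Ico 1 (2 ^ N), f k x -
      ∑ k ∈ Finset.Ico 1 (2 ^ N), f k y| ≤ C * |x - y| ^ γ)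
    (hg : ∀ x ∈ s, Tendsto (fun N => ∑ k ∈ Finset.range N, f (k + 1) x) atTop (𝓝 (g x))) :
    ∀ x ∈ s, ∀ y ∈ s, |g x - g y| ≤ C * |x - y| ^ γ := by
  -- The indices `1 ≤ k < 2 ^ N` are the first `2 ^ N - 1` terms of the shifted series.
  have hsub : Tendsto (fun N : ℕ => 2 ^ N - 1) atTop atTop :=
    (tendsto_sub_atTop_nat 1).comp (tendsto_pow_atTop_atTop_of_one_lt one_lt_two)
  have h2 : ∀ N x, ∑ k ∈ Finset.range (2 ^ N - 1), f (k + 1) x =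
      ∑ k ∈ Finset.Ico 1 (2 ^ N), f k x := fun N x => by
    rw [sum_range_succ_eq_sum_Ico fun k => f k x, Nat.sub_add_cancel Nat.one_le_two_pow]
  intro x hx y hy
  have hx' := (hg x hx).comp hsub
  have hy' := (hg y hy).comp hsub
  refine le_of_tendsto (hx'.sub hy').abs (Eventually.of_forall fun N => ?_)
  simp only [Function.comp, h2]
  exact h N x (hs hx) y (hs hy)

end

/-! ### Hölder exponents in time and in space -/

section

variable {Ω : Type*} [MeasurableSpace Ω] {P : Measure Ω} {W : L2 → Ω → ℝ}

theorem hasDerivAt_one_sub_exp (k : ℕ) (t : ℝ) :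
    HasDerivAt (fun s => 1 - Real.exp (-(k : ℝ) ^ 2 * s))
      ((k : ℝ) ^ 2 * Real.exp (-(k : ℝ) ^ 2 * t)) t := by
  have := (((hasDerivAt_id t).const_mul (-(k : ℝ) ^ 2)).exp).const_sub 1
  simp only [id] at this
  exact this.congr_deriv (by ring)

theorem abs_exp_neg_sq_mul_sub_le {s t : ℝ} (hs : 0 ≤ s) (ht : 0 ≤ t) (k : ℕ) :
    |Real.exp (-(k : ℝ) ^ 2 * s) - Real.exp (-(k : ℝ) ^ 2 * t)| ≤ (k : ℝ) ^ 2 * |s - t| := by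
  have hk : -(k : ℝ) ^ 2 ≤ 0 := neg_nonpos.2 (by positivity)
  refine (abs_exp_sub_exp_le (mul_nonpos_of_nonpos_of_nonneg hk hs)
    (mul_nonpos_of_nonpos_of_nonneg hk ht)).trans (le_of_eq ?_)
  rw [← mul_sub, abs_mul, abs_neg, abs_of_nonneg (by positivity : (0 : ℝ) ≤ (k : ℝ) ^ 2)]

/-- Hölder bounds in time for the random series with coefficients `k⁻ᵃ (1 - exp (-k² t)) d k`. -/
theorem IsWhiteNoise.ae_exists_holder_time (hW : IsWhiteNoise P W) {d : ℕ → ℝ}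
    (hd : ∀ k, |d k| ≤ 1) (a : ℕ) {T : ℝ} (hT : 0 < T) :
    ∀ᵐ ω ∂P, ∀ γ : ℝ, 0 ≤ γ → γ ≤ 1 → γ * 2 + 1 / 2 < a → ∃ C : ℝ, 0 ≤ C ∧
      ∀ N : ℕ, ∀ s ∈ Icc 0 T, ∀ t ∈ Icc 0 T,
        |∑ k ∈ (Finset.Ico 1 (2 ^ N) : Finset ℕ),
            ((k : ℝ) ^ a)⁻¹ * (1 - Real.exp (-(k : ℝ) ^ 2 * s)) * d k * zeta W k ω -
          ∑ k ∈ (Finset.Ico 1 (2 ^ N) : Finset ℕ),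
            ((k : ℝ) ^ a)⁻¹ * (1 - Real.exp (-(k : ℝ) ^ 2 * t)) * d k * zeta W k ω| ≤
          C * |s - t| ^ γ := by
  -- Each time derivative of `exp (-k² t)` costs `k²`, hence `m = 2`.
  refine hW.ae_exists_holder_partial_sums (m := 2) (a := a)
    (c := fun k t => ((k : ℝ) ^ a)⁻¹ * (1 - Real.exp (-(k : ℝ) ^ 2 * t)) * d k)
    (c' := fun k t => ((k : ℝ) ^ a)⁻¹ * ((k : ℝ) ^ 2 * Real.exp (-(k : ℝ) ^ 2 * t)) * d k)
    hT (fun k _ t ht => ?_) (fun k t _ => ?_) (fun k _ t ht => ?_) (fun k _ s hs t ht => ?_)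
  · rw [abs_mul, abs_mul, abs_of_nonneg (by positivity : (0 : ℝ) ≤ ((k : ℝ) ^ a)⁻¹)]
    calc _ ≤ ((k : ℝ) ^ a)⁻¹ * 1 * 1 := by
          gcongr
          · exact abs_one_sub_exp_le_one ht.1 k
          · exact hd k
      _ = _ := by ring
  · exact ((hasDerivAt_one_sub_exp k t).const_mul _).mul_const _
  · rw [abs_mul, abs_of_nonneg (by positivity)]
    calc _ ≤ ((k : ℝ) ^ a)⁻¹ * ((k : ℝ) ^ 2 * 1) * 1 := by
          gcongr
          · exact exp_neg_sq_mul_le_one ht.1 k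
          · exact hd k
      _ = _ := by ring
  · rw [← sub_mul, ← mul_sub, ← mul_sub, abs_mul, abs_mul, abs_mul,
      abs_of_nonneg (by positivity : (0 : ℝ) ≤ ((k : ℝ) ^ a)⁻¹),
      abs_of_nonneg (by positivity : (0 : ℝ) ≤ (k : ℝ) ^ 2)]
    calc _ ≤ ((k : ℝ) ^ a)⁻¹ * ((k : ℝ) ^ 2 * ((k : ℝ) ^ 2 * |s - t|)) * 1 := by
          gcongr
          · exact abs_exp_neg_sq_mul_sub_le hs.1 ht.1 k
          · exact hd k
      _ = _ := by ring

theorem almostHolder_of_forall_exists {f : ℝ → ℝ} {a b β : ℝ} (hβ : β ≤ 1)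
    (h : ∀ γ : ℝ, 0 < γ → γ < β →
      ∃ C : ℝ, ∀ x ∈ Ioo a b, ∀ y ∈ Ioo a b, |f x - f y| ≤ C * |x - y| ^ γ) :
    AlmostHolder β f a b := by
  intro ε hε hεβ
  refine ⟨fun _ => ?_, fun h1 => by linarith⟩
  obtain ⟨C, hC⟩ := h (β - ε) (by linarith) (by linarith)
  exact ⟨_, holderOnWith_of_abs_sub_le (by linarith) hC⟩

theorem IsWhiteNoise.ae_almostHolder_U_time (hW : IsWhiteNoise P W) (x : ℝ) {T : ℝ}
    (hT : 0 < T) : ∀ᵐ ω ∂P, AlmostHolder (3 / 4) (fun t => U W t x ω) 0 T := by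
  filter_upwards [hW.ae_exists_abs_zeta_le, hW.ae_exists_holder_time
    (d := fun k => Real.cos (k * x)) (fun k => Real.abs_cos_le_one _) 2 hT] with ω ⟨Z, hZ, hz⟩ h
  refine almostHolder_of_forall_exists (by norm_num) fun γ hγ hγ1 => ?_
  obtain ⟨C, hC, hb⟩ := h γ hγ.le (by linarith) (by norm_num; linarith)
  have h1 := abs_sub_le_of_tendsto (g := fun t => ∑' k : ℕ, uTerm W t x ω (k + 1))
    (f := fun k t => uTerm W t x ω k) Ioo_subset_Icc_self hb
    fun t ht => (summable_uTerm hz ht.1.le x).hasSum.tendsto_sum_nat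
  have h2 := abs_sub_le_of_lipschitz (f := fun t => t / Real.pi * zeta W 0 ω)
    (s := Ioo 0 T) (D := T) (C := |zeta W 0 ω / Real.pi|) (abs_nonneg _) hγ.le (by linarith)
    (fun s hs t ht => by rw [abs_le]; constructor <;> linarith [hs.1, hs.2, ht.1, ht.2])
    (fun s _ t _ => by rw [← abs_mul]; apply le_of_eq; congr 1; ring)
  refine ⟨|zeta W 0 ω / Real.pi| * T ^ (1 - γ) + 2 / Real.pi * C, fun s hs t ht => ?_⟩
  have e : U W s x ω - U W t x ω =
      (s / Real.pi * zeta W 0 ω - t / Real.pi * zeta W 0 ω) +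
      2 / Real.pi * (∑' k : ℕ, uTerm W s x ω (k + 1) - ∑' k : ℕ, uTerm W t x ω (k + 1)) := by
    unfold U; ring
  rw [e, add_mul]
  refine (abs_add_le _ _).trans (add_le_add (h2 s hs t ht) ?_)
  rw [abs_mul, abs_of_pos (by positivity : 0 < 2 / Real.pi), mul_assoc]
  gcongr
  exact h1 s hs t ht

theorem IsWhiteNoise.ae_almostHolder_spaceDeriv_time (hW : IsWhiteNoise P W) {x : ℝ}
    (hx : x ∈ Icc 0 Real.pi) {T : ℝ} (hT : 0 < T) :
    ∀ᵐ ω ∂P, AlmostHolder (1 / 4) (fun t => spaceDeriv (U W) t x ω) 0 T := by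
  filter_upwards [hW.ae_tendsto_spaceDeriv, hW.ae_exists_holder_time
    -- The rescaled field `(π / 4) U_x` has prefactor `-(2 / 4)`, which keeps `|d k| ≤ 1`.
    (d := fun k => -(2 / 4) * Real.sin (k * x)) (fun k => by
      rw [abs_mul]
      have := Real.abs_sin_le_one (k * x)
      norm_num
      linarith) 1 hT] with ω hs h
  refine almostHolder_of_forall_exists (by norm_num) fun γ hγ hγ1 => ?_
  obtain ⟨C, hC, hb⟩ := h γ hγ.le (by linarith) (by norm_num; linarith)
  have h1 := abs_sub_le_of_tendsto (g := fun t => Real.pi / 4 * spaceDeriv (U W) t x ω)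
    Ioo_subset_Icc_self hb fun t ht => by
      refine ((hs t ht.1 x hx).2.const_mul (Real.pi / 4)).congr fun N => ?_
      rw [← mul_assoc, Finset.mul_sum]
      refine Finset.sum_congr rfl fun k _ => ?_
      unfold uxTerm
      rw [pow_one]
      field_simp
  refine ⟨4 / Real.pi * C, fun s hs t ht => ?_⟩
  have := h1 s hs t ht
  rw [← mul_sub, abs_mul, abs_of_pos (by positivity : 0 < Real.pi / 4)] at this
  rw [mul_assoc, div_mul_eq_mul_div, le_div_iff₀ Real.pi_pos]
  linarith

theorem IsWhiteNoise.ae_almostHolder_U_space (hW : IsWhiteNoise P W) {t : ℝ} (ht : 0 < t) :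
    ∀ᵐ ω ∂P, AlmostHolder (3 / 2) (fun x => U W t x ω) 0 Real.pi := by
  have hpart := hW.ae_exists_holder_partial_sums (m := 1) (a := 1) (p := 0) (q := Real.pi)
    (c := fun k x => (k : ℝ)⁻¹ * (1 - Real.exp (-(k : ℝ) ^ 2 * t)) * Real.sin (k * x))
    (c' := fun k x => (k : ℝ)⁻¹ * (1 - Real.exp (-(k : ℝ) ^ 2 * t)) * (Real.cos (k * x) * k))
    Real.pi_pos
    (fun k _ x _ => by
      rw [abs_mul, abs_mul, pow_one, abs_inv, Nat.abs_cast]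
      calc _ ≤ (k : ℝ)⁻¹ * 1 * 1 := by
            gcongr
            · exact abs_one_sub_exp_le_one ht.le k
            · exact Real.abs_sin_le_one _
        _ = _ := by ring)
    (fun k x _ => by
      have := ((hasDerivAt_id x).const_mul (k : ℝ)).sin
      simp only [id, mul_one] at this
      exact this.const_mul _)
    (fun k _ x _ => by
      rw [abs_mul, abs_mul, abs_mul, pow_one, abs_inv, Nat.abs_cast]
      calc _ ≤ (k : ℝ)⁻¹ * 1 * (1 * k) := by
            gcongr
            · exact abs_one_sub_exp_le_one ht.le k
            · exact Real.abs_cos_le_one _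
        _ = _ := by ring)
    (fun k _ x _ y _ => by
      rw [← mul_sub, ← sub_mul, abs_mul, abs_mul, abs_mul, pow_one, abs_inv, Nat.abs_cast]
      have h2 : |Real.cos (k * x) - Real.cos (k * y)| ≤ k * |x - y| := by
        have := Real.lipschitzWith_cos.dist_le_mul (k * x) (k * y)
        rw [Real.dist_eq, Real.dist_eq, ← mul_sub, abs_mul, Nat.abs_cast] at this
        simpa using this
      calc _ ≤ (k : ℝ)⁻¹ * 1 * (k * |x - y| * k) := by
            gcongr
            exact abs_one_sub_exp_le_one ht.le k
        _ = _ := by ring)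
  filter_upwards [hW.ae_tendsto_spaceDeriv, hW.ae_contDiffOn_U, hpart] with ω hs hC1 hp
  intro ε hε hε1
  refine ⟨fun h1 => ?_, fun h1 => ⟨hC1 t ht, ?_⟩⟩
  -- Orders at most `1` need only that a `C¹` function on a compact interval is Lipschitz.
  · have hc := (hC1 t ht).continuousOn_derivWithin (uniqueDiffOn_Icc Real.pi_pos) le_rfl
    obtain ⟨M, hM⟩ := isCompact_Icc.exists_bound_of_continuousOn hc
    have hM0 : 0 ≤ M := (norm_nonneg _).trans (hM 0 ⟨le_rfl, Real.pi_pos.le⟩)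
    refine ⟨_, holderOnWith_of_abs_sub_le (by linarith) (abs_sub_le_of_lipschitz (D := Real.pi)
      hM0 (by linarith) h1 (fun x hx y hy => ?_) fun x hx y hy => ?_)⟩
    · rw [abs_le]; constructor <;> linarith [hx.1, hx.2, hy.1, hy.2]
    · exact (convex_Icc 0 Real.pi).norm_image_sub_le_of_norm_derivWithin_le
        ((hC1 t ht).differentiableOn one_ne_zero) hM (Ioo_subset_Icc_self hy)
        (Ioo_subset_Icc_self hx)
  · obtain ⟨C, hC, hb⟩ := hp (3 / 2 - ε - 1) (by linarith) (by linarith)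
      (by norm_num; linarith)
    have h2 := abs_sub_le_of_tendsto (g := fun x => -(Real.pi / 2) * spaceDeriv (U W) t x ω)
      (f := fun k x => uxTerm W t x ω k) Ioo_subset_Icc_self hb fun x hx => by
        refine ((hs t ht x (Ioo_subset_Icc_self hx)).2.const_mul (-(Real.pi / 2))).congr
          fun N => ?_
        field_simp
    refine ⟨_, holderOnWith_of_abs_sub_le (C := 2 / Real.pi * C) (by linarith)
      fun x hx y hy => ?_⟩
    have := h2 x hx y hy
    rw [← mul_sub, abs_mul, abs_neg, abs_of_pos (by positivity : 0 < Real.pi / 2)] at this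
    rw [mul_assoc, div_mul_eq_mul_div, le_div_iff₀ Real.pi_pos]
    unfold spaceDeriv at this
    linarith

end

/-! ### Cosine expansion of test functions and of `W(φ)` -/

/-- The cosine coefficient `∫_0^π cos (k x) φ(x) dx`. -/
noncomputable def cosCoeff (φ : ℝ → ℝ) (k : ℕ) : ℝ :=
  ∫ x in 0..Real.pi, Real.cos (k * x) * φ x

theorem fourierCoeff_even_extension {φ : ℝ → ℝ} (hφ : Continuous φ) [Fact (0 < 2 * Real.pi)]
    (n : ℤ) :
    fourierCoeff (AddCircle.liftIco (2 * Real.pi) (-Real.pi) fun x => ((φ |x| : ℝ) : ℂ)) n =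
      ((Real.pi⁻¹ * cosCoeff φ n.natAbs : ℝ) : ℂ) := by
  let g : ℝ → ℂ := fun x => Complex.exp (-n * x * Complex.I) * ((φ |x| : ℝ) : ℂ)
  have hg : Continuous g := by fun_prop
  have h1 : ∫ x in (-Real.pi)..(-Real.pi + 2 * Real.pi),
      fourier (-n) (x : AddCircle (2 * Real.pi)) •
        AddCircle.liftIco (2 * Real.pi) (-Real.pi) (fun x => ((φ |x| : ℝ) : ℂ)) x =
      ∫ x in (-Real.pi)..Real.pi, g x := by
    have e : -Real.pi + 2 * Real.pi = Real.pi := by ring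
    rw [e]
    refine intervalIntegral.integral_congr_Ioo_of_le (by linarith [Real.pi_pos]) fun x hx => ?_
    have hx' : x ∈ Ico (-Real.pi) (-Real.pi + 2 * Real.pi) := by
      rw [e]; exact Ioo_subset_Ico_self hx
    have hpi : (Real.pi : ℂ) ≠ 0 := by exact_mod_cast Real.pi_ne_zero
    simp only [g]
    rw [AddCircle.liftIco_coe_apply hx', fourier_coe_apply, smul_eq_mul]
    congr 2
    push_cast
    field_simp
  have h2 : ∫ x in (-Real.pi)..Real.pi, g x = ((2 * cosCoeff φ n.natAbs : ℝ) : ℂ) := by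
    rw [← intervalIntegral.integral_add_adjacent_intervals (b := 0) (hg.intervalIntegrable _ _)
      (hg.intervalIntegrable _ _)]
    have h3 : ∫ x in (-Real.pi)..0, g x = ∫ x in 0..Real.pi, g (-x) := by
      rw [intervalIntegral.integral_comp_neg, neg_zero]
    rw [h3, ← intervalIntegral.integral_add
      ((show Continuous fun x => g (-x) from hg.comp continuous_neg).intervalIntegrable _ _)
      (hg.intervalIntegrable _ _), cosCoeff,
      ← intervalIntegral.integral_const_mul, ← intervalIntegral.integral_ofReal]
    refine intervalIntegral.integral_congr fun x hx => ?_
    rw [uIcc_of_le Real.pi_pos.le] at hx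
    simp only [g]
    rw [abs_neg, abs_of_nonneg hx.1, ← add_mul]
    have hcos : Real.cos ((n.natAbs : ℝ) * x) = Real.cos ((n : ℝ) * x) := by
      have : (n.natAbs : ℝ) = |(n : ℝ)| := by
        rw [Nat.cast_natAbs]; push_cast; rfl
      rw [this, ← abs_of_nonneg hx.1, ← abs_mul, Real.cos_abs, abs_of_nonneg hx.1]
    rw [hcos]
    push_cast
    rw [← mul_assoc, Complex.two_cos]
    congr 1
    congr 1 <;> congr 1 <;> ring
  rw [fourierCoeff_eq_intervalIntegral _ _ (-Real.pi), h1, h2]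
  rw [Complex.real_smul, ← Complex.ofReal_mul]
  congr 1
  have := Real.pi_ne_zero
  field_simp

/-- The coefficient of `cos (k ·)` in the cosine expansion of `φ` on `[0, π]`. -/
noncomputable def cosSeriesCoeff (φ : ℝ → ℝ) (k : ℕ) : ℝ :=
  (if k = 0 then 1 else 2) / Real.pi * cosCoeff φ k

/-- This is the Fourier series of the even extension of `φ` to the circle of length `2π`, which is
continuous there because it agrees at `±π`. The point `π` is excluded only because the circle is
parametrized by `[-π, π)`. -/
theorem hasSum_cosSeriesCoeff_mul_cos {φ : ℝ → ℝ} (hφ : Continuous φ)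
    (hs : Summable fun k => |cosCoeff φ k|) {x : ℝ} (hx : x ∈ Ico 0 Real.pi) :
    HasSum (fun k : ℕ => cosSeriesCoeff φ k * Real.cos (k * x)) (φ x) := by
  have : Fact (0 < 2 * Real.pi) := ⟨by positivity⟩
  let F : ℝ → ℂ := fun x => ((φ |x| : ℝ) : ℂ)
  have e : -Real.pi + 2 * Real.pi = Real.pi := by ring
  have hcont : Continuous (AddCircle.liftIco (2 * Real.pi) (-Real.pi) F) := by
    refine AddCircle.liftIco_continuous ?_ (by fun_prop)
    simp only [F, e, abs_neg]
  let f : C(AddCircle (2 * Real.pi), ℂ) := ⟨_, hcont⟩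
  have hcoef : ∀ n : ℤ, fourierCoeff f n = ((Real.pi⁻¹ * cosCoeff φ n.natAbs : ℝ) : ℂ) :=
    fourierCoeff_even_extension hφ
  have hsum : Summable (fourierCoeff f) := by
    have hr : Summable fun n : ℤ => |cosCoeff φ n.natAbs| :=
      Summable.of_nat_of_neg (by simpa using hs) (by simpa using hs)
    refine Summable.of_norm_bounded (hr.mul_left Real.pi⁻¹) fun n => ?_
    rw [hcoef, Complex.norm_real, Real.norm_eq_abs, abs_mul, abs_of_pos (by positivity)]
  have h1 := (has_pointwise_sum_fourier_series_of_summable hsum (x : AddCircle _)).nat_add_neg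
  have hfx : f (x : AddCircle (2 * Real.pi)) = (φ x : ℂ) := by
    change AddCircle.liftIco (2 * Real.pi) (-Real.pi) F x = _
    rw [AddCircle.liftIco_coe_apply ⟨by linarith [hx.1, Real.pi_pos], by rw [e]; exact hx.2⟩]
    simp only [F, abs_of_nonneg hx.1]
  rw [hfx] at h1
  have h2 : HasSum (fun n : ℕ => 2 / Real.pi * cosCoeff φ n * Real.cos (n * x))
      (φ x + Real.pi⁻¹ * cosCoeff φ 0) := by
    rw [← Complex.hasSum_ofReal]
    have hpi : (Real.pi : ℂ) ≠ 0 := by exact_mod_cast Real.pi_ne_zero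
    convert! h1 using 1
    · funext n
      simp only [hcoef, Int.natAbs_neg, Int.natAbs_natCast, fourier_coe_apply, smul_eq_mul]
      rw [← mul_add]
      have : Complex.exp (2 * Real.pi * Complex.I * ((n : ℤ) : ℂ) * x / (2 * Real.pi : ℝ)) +
          Complex.exp (2 * Real.pi * Complex.I * ((-n : ℤ) : ℂ) * x / (2 * Real.pi : ℝ)) =
          2 * Complex.cos (n * x) := by
        rw [Complex.two_cos]
        congr 1 <;> congr 1 <;> push_cast <;> field_simp
      rw [this]
      push_cast
      field_simp
    · simp [hcoef]
  -- Pairing `n` with `-n` counts the constant mode twice; removing one copy leaves `1/π` at `k = 0`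
  -- and `2/π` elsewhere.
  have h3 := h2.sub (hasSum_ite_eq (0 : ℕ) (Real.pi⁻¹ * cosCoeff φ 0))
  rw [add_sub_cancel_right] at h3
  refine h3.congr_fun fun n => ?_
  unfold cosSeriesCoeff
  split_ifs with hn
  · subst hn
    simp
    ring
  · ring

theorem toL2_congr {f g : ℝ → ℝ} (hf : Continuous f) (h : f = g) :
    toL2 f hf = toL2 g (h ▸ hf) := by
  subst h; rfl

theorem toL2_sub_mul_cos {f : ℝ → ℝ} (hf : Continuous f) (a : ℝ) (k : ℕ) :
    toL2 (fun x => f x - a * Real.cos (k * x)) (by fun_prop) = toL2 f hf - a • cosL2 k := rfl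

theorem toL2_sub_sum_cos {f : ℝ → ℝ} (hf : Continuous f) (a : ℕ → ℝ) (N : ℕ) :
    toL2 (fun x => f x - ∑ k ∈ Finset.range N, a k * Real.cos (k * x)) (by fun_prop) =
      toL2 f hf - ∑ k ∈ Finset.range N, a k • cosL2 k := by
  induction N with
  | zero => simp
  | succ N ih =>
    rw [Finset.sum_range_succ, ← sub_sub, ← ih, ← toL2_sub_mul_cos]
    refine toL2_congr _ ?_
    funext x
    rw [Finset.sum_range_succ, sub_sub]

theorem tendsto_norm_toL2_sub_sum_cos {φ : ℝ → ℝ} (hφ : Continuous φ)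
    (hs : Summable fun k => |cosCoeff φ k|) :
    Tendsto (fun N : ℕ => ‖toL2 φ hφ - ∑ k ∈ Finset.range N, cosSeriesCoeff φ k • cosL2 k‖)
      atTop (𝓝 0) := by
  have ha : Summable fun k => |cosSeriesCoeff φ k| := by
    refine Summable.of_nonneg_of_le (fun _ => abs_nonneg _) (fun k => ?_)
      (hs.mul_left (2 / Real.pi))
    rw [cosSeriesCoeff, abs_mul]
    gcongr
    rw [abs_of_nonneg (by positivity)]
    gcongr
    split_ifs <;> norm_num
  have hlim : Tendsto (fun N => √Real.pi * ∑' k, |cosSeriesCoeff φ (k + N)|) atTop (𝓝 0) := by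
    simpa using (tendsto_sum_nat_add fun k => |cosSeriesCoeff φ k|).const_mul (√Real.pi)
  refine squeeze_zero (fun _ => norm_nonneg _) (fun N => ?_) hlim
  rw [← toL2_sub_sum_cos hφ]
  have hτ : 0 ≤ ∑' k, |cosSeriesCoeff φ (k + N)| := tsum_nonneg fun _ => abs_nonneg _
  have hcl : ∀ x ∈ Icc 0 Real.pi, |φ x - ∑ k ∈ Finset.range N,
      cosSeriesCoeff φ k * Real.cos (k * x)| ≤ ∑' k, |cosSeriesCoeff φ (k + N)| := by
    have hIco : ∀ x ∈ Ico 0 Real.pi, |φ x - ∑ k ∈ Finset.range N,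
        cosSeriesCoeff φ k * Real.cos (k * x)| ≤ ∑' k, |cosSeriesCoeff φ (k + N)| := by
      intro x hx
      have h1 := (hasSum_nat_add_iff' N).2 (hasSum_cosSeriesCoeff_mul_cos hφ hs hx)
      rw [← h1.tsum_eq, ← Real.norm_eq_abs]
      refine tsum_of_norm_bounded ((summable_nat_add_iff N).2 ha).hasSum fun k => ?_
      rw [norm_mul]
      exact mul_le_of_le_one_right (norm_nonneg _) (Real.abs_cos_le_one _)
    -- The bound extends to the end point `π` by continuity.
    have : Icc 0 Real.pi ⊆ {x | |φ x - ∑ k ∈ Finset.range N,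
        cosSeriesCoeff φ k * Real.cos (k * x)| ≤ ∑' k, |cosSeriesCoeff φ (k + N)|} := by
      rw [← closure_Ico Real.pi_pos.ne]
      exact closure_minimal hIco (isClosed_le (by fun_prop) continuous_const)
    exact fun x hx => this hx
  refine abs_le_of_sq_le_sq' ?_ (by positivity) |>.2
  refine (norm_sq_toL2_le _ hcl).trans (le_of_eq ?_)
  rw [mul_pow, Real.sq_sqrt Real.pi_pos.le]

/-- `W` is continuous only in mean square, so one passes to a subsequence whose remainders have norm
at most `2^(-j)`; the Borel–Cantelli bound, with one variable per level, sends their noise to zero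
almost surely. The assumed convergence of the full series identifies the limit. -/
theorem IsWhiteNoise.ae_toL2_eq_tsum {Ω : Type*} [MeasurableSpace Ω] {P : Measure Ω}
    {W : L2 → Ω → ℝ} (hW : IsWhiteNoise P W) {φ : ℝ → ℝ} (hφ : Continuous φ)
    (hs : Summable fun k => |cosCoeff φ k|)
    (hζ : ∀ᵐ ω ∂P, Summable fun k => cosSeriesCoeff φ k * zeta W k ω) :
    ∀ᵐ ω ∂P, W (toL2 φ hφ) ω = ∑' k, cosSeriesCoeff φ k * zeta W k ω := by
  have hlim := tendsto_norm_toL2_sub_sum_cos hφ hs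
  have hN : ∀ j : ℕ, ∃ N ≥ j,
      ‖toL2 φ hφ - ∑ k ∈ Finset.range N, cosSeriesCoeff φ k • cosL2 k‖ ≤ (1 / 2 : ℝ) ^ j := by
    intro j
    obtain ⟨N, h1, h2⟩ := ((hlim.eventually (gt_mem_nhds (by positivity :
      (0 : ℝ) < (1 / 2) ^ j))).and (eventually_ge_atTop j)).exists
    exact ⟨N, h2, h1.le⟩
  choose N hNj hN using hN
  let h : ℕ → L2 := fun j =>
    toL2 φ hφ - ∑ k ∈ Finset.range (N j), cosSeriesCoeff φ k • cosL2 k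
  have hWh : ∀ᵐ ω ∂P, ∀ j, W (h j) ω =
      W (toL2 φ hφ) ω - ∑ k ∈ Finset.range (N j), cosSeriesCoeff φ k * zeta W k ω := by
    refine ae_all_iff.2 fun j => ?_
    filter_upwards [hW.ae_sum_zeta (Finset.range (N j)) (cosSeriesCoeff φ),
      hW.ae_add (h j) (∑ k ∈ Finset.range (N j), cosSeriesCoeff φ k • cosL2 k)] with ω h1 h2
    rw [h1, sub_add_cancel] at h2
    linarith
  filter_upwards [hζ, hWh, hW.ae_exists_forall_abs_le (fun j => {j}) (fun j _ => h j)
    (σ := fun j => (1 / 2 : ℝ) ^ j) (fun j => by positivity) (fun j _ _ => hN j)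
    (K := 1) (A := 1) one_pos (fun j => by simp)] with ω h1 h2 ⟨C, hC, h3⟩
  have hN' : Tendsto N atTop atTop := tendsto_atTop_mono hNj tendsto_id
  have h4 : Tendsto (fun j => W (h j) ω) atTop (𝓝 0) := by
    refine squeeze_zero_norm (fun j => h3 j j (Finset.mem_singleton_self j)) ?_
    simpa using ((summable_add_one_mul_geometric (r := 1 / 2) (by norm_num)
      (by norm_num)).tendsto_atTop_zero).const_mul C
  have h5 := (h1.hasSum.tendsto_sum_nat.comp hN').const_sub (W (toL2 φ hφ) ω)
  have h6 := tendsto_nhds_unique (h4.congr h2) h5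
  linarith

/-- Two integrations by parts: the Neumann conditions on `φ` kill the first boundary term, and `sin
(kπ) = 0` kills the second. -/
theorem cosCoeff_iteratedDeriv_two {φ : ℝ → ℝ} (hφ : ContDiff ℝ 2 φ) (h0 : deriv φ 0 = 0)
    (hπ : deriv φ Real.pi = 0) (k : ℕ) :
    cosCoeff (iteratedDeriv 2 φ) k = -(k : ℝ) ^ 2 * cosCoeff φ k := by
  have hd : ContDiff ℝ 1 (deriv φ) := hφ.deriv'
  have hd0 : Continuous φ := hφ.continuous
  have hd1 : Continuous (deriv φ) := hd.continuous
  have hd2 : Continuous (deriv (deriv φ)) := hd.continuous_deriv le_rfl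
  have hcos : ∀ x : ℝ, HasDerivAt (fun x : ℝ => Real.cos (k * x)) (-Real.sin (k * x) * k) x :=
    fun x => by simpa using ((hasDerivAt_id x).const_mul (k : ℝ)).cos
  have hsin : ∀ x : ℝ, HasDerivAt (fun x : ℝ => Real.sin (k * x)) (Real.cos (k * x) * k) x :=
    fun x => by simpa using ((hasDerivAt_id x).const_mul (k : ℝ)).sin
  have i1 := intervalIntegral.integral_mul_deriv_eq_deriv_mul (a := 0) (b := Real.pi)
    (fun x _ => hcos x)
    (fun x _ => (hd.differentiable one_ne_zero x).hasDerivAt)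
    (Continuous.intervalIntegrable (by fun_prop) _ _) (hd2.intervalIntegrable _ _)
  have i2 := intervalIntegral.integral_mul_deriv_eq_deriv_mul (a := 0) (b := Real.pi)
    (fun x _ => hsin x)
    (fun x _ => (hφ.differentiable two_ne_zero x).hasDerivAt)
    (Continuous.intervalIntegrable (by fun_prop) _ _) (hd1.intervalIntegrable _ _)
  simp only [h0, hπ, mul_zero, sub_zero, zero_sub, Real.sin_nat_mul_pi, zero_mul,
    Real.sin_zero] at i1 i2
  have e1 : ∀ x, -Real.sin (k * x) * k * deriv φ x = -k * (Real.sin (k * x) * deriv φ x) :=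
    fun x => by ring
  have e2 : ∀ x, Real.cos (k * x) * k * φ x = k * (Real.cos (k * x) * φ x) := fun x => by ring
  simp_rw [e1, intervalIntegral.integral_const_mul, i2, e2,
    intervalIntegral.integral_const_mul] at i1
  rw [cosCoeff, cosCoeff, iteratedDeriv_succ, iteratedDeriv_one, i1]
  ring

theorem exists_abs_cosCoeff_le {φ : ℝ → ℝ} (hφ : Continuous φ) :
    ∃ M : ℝ, 0 ≤ M ∧ ∀ k, |cosCoeff φ k| ≤ M := by
  obtain ⟨M, hM⟩ := isCompact_Icc.exists_bound_of_continuousOn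
    (s := Icc (0 : ℝ) Real.pi) hφ.continuousOn
  have hM0 : 0 ≤ M := (norm_nonneg _).trans (hM 0 ⟨le_rfl, Real.pi_pos.le⟩)
  refine ⟨M * |Real.pi - 0|, by positivity, fun k => ?_⟩
  rw [cosCoeff, ← Real.norm_eq_abs]
  refine intervalIntegral.norm_integral_le_of_norm_le_const fun x hx => ?_
  rw [uIoc_of_le Real.pi_pos.le] at hx
  rw [norm_mul]
  exact (mul_le_of_le_one_left (norm_nonneg _) (Real.abs_cos_le_one _)).trans
    (hM x (Ioc_subset_Icc_self hx))

theorem hasSum_integral_of_abs_le {F : ℕ → ℝ → ℝ} {f : ℝ → ℝ} {a b : ℝ} (hab : a ≤ b)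
    {u : ℕ → ℝ} (hu : Summable u) (hF : ∀ n, Continuous (F n))
    (hb : ∀ n, ∀ x ∈ Icc a b, |F n x| ≤ u n)
    (hf : ∀ x ∈ Icc a b, HasSum (fun n => F n x) (f x)) :
    HasSum (fun n => ∫ x in a..b, F n x) (∫ x in a..b, f x) := by
  have hsub : ∀ x, x ∈ uIoc a b → x ∈ Icc a b := fun x hx => by
    rw [uIoc_of_le hab] at hx
    exact Ioc_subset_Icc_self hx
  exact intervalIntegral.hasSum_integral_of_dominated_convergence (fun n _ => u n)
    (fun n => (hF n).aestronglyMeasurable) (fun n => ae_of_all _ fun x hx => hb n x (hsub x hx))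
    (ae_of_all _ fun _ _ => hu) intervalIntegrable_const
    (ae_of_all _ fun x hx => hf x (hsub x hx))

/-! ### The weak equation -/

section

variable {Ω : Type*} {W : L2 → Ω → ℝ}

theorem hasSum_integral_U_mul {ω : Ω} {Z : ℝ} (hz : ∀ k : ℕ, k ≠ 0 → |zeta W k ω| ≤ Z * √k)
    {ψ : ℝ → ℝ} (hψ : Continuous ψ) {t : ℝ} (ht : 0 ≤ t) :
    HasSum (fun k : ℕ => 2 / Real.pi * ((((k + 1 : ℕ) : ℝ) ^ 2)⁻¹ *
        (1 - Real.exp (-((k + 1 : ℕ) : ℝ) ^ 2 * t)) * zeta W (k + 1) ω * cosCoeff ψ (k + 1)))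
      ((∫ x in 0..Real.pi, U W t x ω * ψ x) - t / Real.pi * zeta W 0 ω * cosCoeff ψ 0) := by
  obtain ⟨M, hM⟩ := isCompact_Icc.exists_bound_of_continuousOn
    (s := Icc (0 : ℝ) Real.pi) hψ.continuousOn
  have hc : ∀ k : ℕ, Continuous fun x => uTerm W t x ω (k + 1) * ψ x := fun k => by
    unfold uTerm; fun_prop
  have h1 := hasSum_integral_of_abs_le (F := fun k x => uTerm W t x ω (k + 1) * ψ x)
    (f := fun x => (∑' k, uTerm W t x ω (k + 1)) * ψ x) Real.pi_pos.le
    ((summable_mul_rpow_inv Z).mul_right M) hc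
    (fun k x hx => by
      rw [abs_mul]
      have := abs_uTerm_le hz ht x k
      exact mul_le_mul this (hM x hx) (abs_nonneg _) ((abs_nonneg _).trans this))
    (fun x _ => (summable_uTerm hz ht x).hasSum.mul_right _)
  have hcU : ContinuousOn (fun x => (∑' k, uTerm W t x ω (k + 1)) * ψ x)
      (uIcc 0 Real.pi) := by
    refine ContinuousOn.mul (continuousOn_tsum (fun k => ?_) (summable_mul_rpow_inv Z)
      fun k x _ => abs_uTerm_le hz ht x k) hψ.continuousOn
    unfold uTerm
    fun_prop
  have h2 : (∫ x in 0..Real.pi, U W t x ω * ψ x) - t / Real.pi * zeta W 0 ω * cosCoeff ψ 0 =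
      2 / Real.pi * ∫ x in 0..Real.pi, (∑' k, uTerm W t x ω (k + 1)) * ψ x := by
    rw [cosCoeff, ← intervalIntegral.integral_const_mul, ← intervalIntegral.integral_const_mul,
      sub_eq_iff_eq_add, ← intervalIntegral.integral_add (hcU.intervalIntegrable.const_mul _)
      (Continuous.intervalIntegrable (by fun_prop) _ _)]
    refine intervalIntegral.integral_congr fun x _ => ?_
    simp only [U, Nat.cast_zero, zero_mul, Real.cos_zero]
    ring
  rw [h2]
  refine (h1.mul_left (2 / Real.pi)).congr_fun fun k => ?_
  congr 1
  rw [cosCoeff, ← intervalIntegral.integral_const_mul]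
  refine intervalIntegral.integral_congr fun x _ => ?_
  simp only [uTerm]
  ring

theorem integral_one_sub_exp {k : ℕ} (hk : k ≠ 0) (t : ℝ) :
    ∫ s in 0..t, (1 - Real.exp (-(k : ℝ) ^ 2 * s)) =
      t - ((k : ℝ) ^ 2)⁻¹ * (1 - Real.exp (-(k : ℝ) ^ 2 * t)) := by
  have hk' : (k : ℝ) ^ 2 ≠ 0 := by positivity
  have hd : ∀ s ∈ uIcc 0 t, HasDerivAt
      (fun s => s - ((k : ℝ) ^ 2)⁻¹ * (1 - Real.exp (-(k : ℝ) ^ 2 * s)))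
      (1 - Real.exp (-(k : ℝ) ^ 2 * s)) s := fun s _ => by
    refine ((hasDerivAt_id s).sub ((hasDerivAt_one_sub_exp k s).const_mul _)).congr_deriv ?_
    field_simp
  rw [intervalIntegral.integral_eq_sub_of_hasDerivAt hd
    (Continuous.intervalIntegrable (by fun_prop) _ _)]
  simp

/-- For `k ≥ 1` the identity is `k⁻²(1 - exp (-k² t)) = t - ∫₀ᵗ (1 - exp (-k² s)) ds`, multiplied by
`b k` times `k²`-free factors and summed. The event does not depend on `t`. -/
theorem integral_U_mul_eq {ω : Ω} {Z : ℝ} (hz : ∀ k : ℕ, k ≠ 0 → |zeta W k ω| ≤ Z * √k)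
    {φ : ℝ → ℝ} (hφ : ContDiff ℝ 2 φ) (h0 : deriv φ 0 = 0) (hπ : deriv φ Real.pi = 0)
    (hs : Summable fun k => cosSeriesCoeff φ k * zeta W k ω) {t : ℝ} (ht : 0 ≤ t) :
    ∫ x in 0..Real.pi, U W t x ω * φ x =
      (∫ s in 0..t, ∫ x in 0..Real.pi, U W s x ω * iteratedDeriv 2 φ x) +
        t * ∑' k, cosSeriesCoeff φ k * zeta W k ω := by
  have hψ : Continuous (iteratedDeriv 2 φ) := hφ.continuous_iteratedDeriv 2 le_rfl
  let b : ℕ → ℝ := fun k => cosSeriesCoeff φ (k + 1) * zeta W (k + 1) ω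
  have hb : ∀ k, b k = 2 / Real.pi * (zeta W (k + 1) ω * cosCoeff φ (k + 1)) := fun k => by
    simp only [b, cosSeriesCoeff, if_neg (Nat.succ_ne_zero k)]
    ring
  have hbs : Summable b := (summable_nat_add_iff 1).2 hs
  have hsum : ∑' k, cosSeriesCoeff φ k * zeta W k ω =
      1 / Real.pi * cosCoeff φ 0 * zeta W 0 ω + ∑' k, b k := by
    rw [hs.tsum_eq_zero_add]
    simp only [cosSeriesCoeff, if_true, b]
  have hinner : ∀ s ∈ Icc 0 t, HasSum
      (fun k : ℕ => -b k * (1 - Real.exp (-((k + 1 : ℕ) : ℝ) ^ 2 * s)))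
      (∫ x in 0..Real.pi, U W s x ω * iteratedDeriv 2 φ x) := by
    intro s hs
    have := hasSum_integral_U_mul hz hψ hs.1
    -- The constant mode of `φ''` vanishes, so the linearly growing `ζ_0` term drops out here.
    rw [cosCoeff_iteratedDeriv_two hφ h0 hπ 0] at this
    simp only [Nat.cast_zero, ne_eq, OfNat.ofNat_ne_zero, not_false_eq_true, zero_pow, neg_zero,
      zero_mul, mul_zero, sub_zero] at this
    refine this.congr_fun fun k => ?_
    rw [cosCoeff_iteratedDeriv_two hφ h0 hπ, hb]
    have : ((k + 1 : ℕ) : ℝ) ≠ 0 := by positivity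
    field_simp
  have houter := hasSum_integral_of_abs_le ht hbs.abs (fun k => by fun_prop)
    (fun k s hs => by
      rw [abs_mul, abs_neg]
      exact mul_le_of_le_one_right (abs_nonneg _) (abs_one_sub_exp_le_one hs.1 (k + 1))) hinner
  have hlhs := hasSum_integral_U_mul hz hφ.continuous ht
  have htot := houter.add (hbs.hasSum.mul_left t)
  have key := hlhs.unique (htot.congr_fun fun k => ?_)
  · rw [hsum]
    linear_combination key
  · rw [intervalIntegral.integral_const_mul, integral_one_sub_exp (Nat.succ_ne_zero k), hb]
    ring

theorem IsWhiteNoise.isNeumannSolution_U [MeasurableSpace Ω] {P : Measure Ω}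
    (hW : IsWhiteNoise P W) : IsNeumannSolution P W (U W) where
  continuous := by
    filter_upwards [hW.ae_exists_abs_zeta_le] with ω ⟨Z, _, hz⟩
    exact (continuousOn_U hz).mono (prod_mono_right (subset_univ _))
  initial := ae_of_all _ fun ω x _ => U_zero x ω
  equation := by
    intro φ hφ h0 hπ
    obtain ⟨M, hM0, hM⟩ := exists_abs_cosCoeff_le (hφ.continuous_iteratedDeriv 2 le_rfl)
    -- Boundedness of the coefficients of `φ''` gives decay `k⁻²` for those of `φ`; against `|ζ_k| ≤
    -- Z √k` this leaves the summable `k^(-3/2)`.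
    have hk : ∀ k : ℕ, |cosCoeff φ (k + 1)| ≤ M * (((k + 1 : ℕ) : ℝ) ^ 2)⁻¹ := fun k => by
      have := hM (k + 1)
      rw [cosCoeff_iteratedDeriv_two hφ h0 hπ, abs_mul, abs_neg, abs_of_nonneg (by positivity)]
        at this
      rw [← div_eq_mul_inv, le_div_iff₀ (by positivity)]
      linarith
    have hs : Summable fun k => |cosCoeff φ k| := by
      rw [← summable_nat_add_iff 1]
      refine Summable.of_nonneg_of_le (fun _ => abs_nonneg _) hk (Summable.mul_left _ ?_)
      exact (summable_nat_add_iff 1).2 (Real.summable_nat_pow_inv.2 one_lt_two)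
    have hζ : ∀ᵐ ω ∂P, Summable fun k => cosSeriesCoeff φ k * zeta W k ω := by
      filter_upwards [hW.ae_exists_abs_zeta_le] with ω ⟨Z, hZ, hz⟩
      rw [← summable_nat_add_iff 1]
      refine Summable.of_norm_bounded (summable_mul_rpow_inv (2 / Real.pi * M * Z)) fun k => ?_
      rw [← sq_inv_mul_sqrt (Nat.succ_ne_zero k), norm_mul, cosSeriesCoeff,
        if_neg (Nat.succ_ne_zero k), norm_mul, Real.norm_of_nonneg (by positivity)]
      calc _ ≤ 2 / Real.pi * (M * (((k + 1 : ℕ) : ℝ) ^ 2)⁻¹) * (Z * √(k + 1 : ℕ)) := by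
            gcongr
            · exact hk k
            · exact hz _ (Nat.succ_ne_zero k)
        _ = _ := by ring
    filter_upwards [hW.ae_exists_abs_zeta_le, hζ, hW.ae_toL2_eq_tsum hφ.continuous hs hζ]
      with ω ⟨Z, hZ, hz⟩ h1 h2 t ht
    rw [h2]
    exact integral_U_mul_eq hz hφ h0 hπ h1 ht

end

end AdditiveNoise

theorem mainTheorem5 {Ω : Type*} [MeasurableSpace Ω] (P : Measure Ω) [IsProbabilityMeasure P]
    (W : AdditiveNoise.L2 → Ω → ℝ) (hW : AdditiveNoise.IsWhiteNoise P W) :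
    -- the series defining `U` converges (absolutely), and `U` solves the equation
    (∀ t : ℝ, 0 < t → ∀ x ∈ Icc 0 Real.pi, ∀ᵐ ω ∂P,
      Summable (fun k : ℕ => AdditiveNoise.uTerm W t x ω (k + 1))) ∧
    AdditiveNoise.IsNeumannSolution P W (AdditiveNoise.U W) ∧
    -- `U_x` is given by the series differentiated term by term
    (∀ t : ℝ, 0 < t → ∀ x ∈ Icc 0 Real.pi, ∀ᵐ ω ∂P,
      Tendsto (fun N : ℕ => -(2 / Real.pi) *
          ∑ k ∈ Finset.range N, AdditiveNoise.uxTerm W t x ω (k + 1)) atTop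
        (𝓝 (AdditiveNoise.spaceDeriv (AdditiveNoise.U W) t x ω))) ∧
    -- regularity of `U` in time
    (∀ x ∈ Icc 0 Real.pi, ∀ T : ℝ, 0 < T → ∀ᵐ ω ∂P,
      AdditiveNoise.AlmostHolder (3 / 4) (fun t => AdditiveNoise.U W t x ω) 0 T) ∧
    -- existence of `U_x` and its regularity in time
    (∀ x ∈ Icc 0 Real.pi, ∀ T : ℝ, 0 < T → ∀ᵐ ω ∂P,
      (∀ t ∈ Ioo 0 T, DifferentiableWithinAt ℝ (fun y => AdditiveNoise.U W t y ω)
        (Icc 0 Real.pi) x) ∧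
      AdditiveNoise.AlmostHolder (1 / 4)
        (fun t => AdditiveNoise.spaceDeriv (AdditiveNoise.U W) t x ω) 0 T) ∧
    -- regularity of `U` in space
    (∀ t : ℝ, 0 < t → ∀ᵐ ω ∂P,
      AdditiveNoise.AlmostHolder (3 / 2) (fun x => AdditiveNoise.U W t x ω) 0 Real.pi) := by
  refine ⟨fun t ht x _ => ?_, hW.isNeumannSolution_U, fun t ht x hx => ?_,
    fun x _ T hT => hW.ae_almostHolder_U_time x hT, fun x hx T hT => ?_,
    fun t ht => hW.ae_almostHolder_U_space ht⟩
  · filter_upwards [hW.ae_exists_abs_zeta_le] with ω ⟨Z, _, hz⟩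
    exact AdditiveNoise.summable_uTerm hz ht.le x
  · filter_upwards [hW.ae_tendsto_spaceDeriv] with ω h
    exact (h t ht x hx).2
  · filter_upwards [hW.ae_tendsto_spaceDeriv, hW.ae_almostHolder_spaceDeriv_time hx hT]
      with ω h1 h2
    exact ⟨fun t ht => (h1 t ht.1 x hx).1.differentiableAt.differentiableWithinAt, h2⟩
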